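/- Graphs are finite multigraphs (multiple edges and loops are allowed). A \emph{mixing involution} of a graph $G$ is an automorphism $\iota$ of $G$ of order two, acting on vertices and edges, such that every edge $e$ between $x$ and $y$ with $\iota(e)=e$ satisfies $\iota(x)=y$. The quotient $G/\iota$ is the graph whose vertices are the sets $\{v,\iota(v)\}$, $v$ a vertex of $G$, and whose edges are the sets $\{e,\iota(e)\}$, $e$ an edge of $G$ between $x$ and $y$ with $\{x,\iota(x)\}\neq\{y,\iota(y)\}$; this edge joins $\{x,\iota(x)\}$ and $\{y,\iota(y)\}$. A connected graph $G$ with a mixing involution $\iota$ such that $G/\iota$ is a tree is called \emph{hyperelliptic}, and $\iota$ is called a \emph{hyperelliptic involution} of $G$. \textbf{Theorem.} Every hyperelliptic graph $G$ is planar. Moreover, for every hyperelliptic involution $\iota$ of $G$ there is an embedding $\rho$ of $G$ in $\mathbb{R}^2$ with the following properties. (1) The embedding is symmetric under $\iota$: the reflection $r(x,y)=(-x,y)$ satisfies $\rho(\iota(v))=r(\rho(v))$ for every vertex $v$, and $\rho(\iota(e))=r(\rho(e))$ for every edge $e$ of $G$, except that for an edge $e$ between two distinct vertices $v$ and $\iota(v)$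 the condition is $\rho(e)=r(\rho(e))$. (For edges $e$ with $\iota(e)=e$ there is no difference. An edge between distinct vertices $v$ and $\iota(v)$ has to cross the axis of $r$, so the curves of two such edges that $\iota$ swaps cannot be mirror images of each other.) (2) Any two distinct vertices $v$ and $\iota(v)$ swapped by $\iota$ lie on a common face of $\rho$, that is, both $\rho(v)$ and $\rho(\iota(v))$ lie on the boundary of one connected component of $\mathbb{R}^2\setminus\rho(G)$. -/

import Mathlib

open Set
open scoped Graph

namespace Graph

variable {α β : Type*}

/-! ### Connected graphs and trees (loops and multiple edges are allowed) -/

/-- A graph is connected if it has a vertex and any two vertices are joined by a chain of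
adjacent vertices. -/
def IsConnected (G : Graph α β) : Prop :=
  V(G).Nonempty ∧ ∀ x ∈ V(G), ∀ y ∈ V(G), Relation.ReflTransGen G.Adj x y

/-- `v` and `e` list the vertices and the edges of a cycle of length `n + 1`, in cyclic order
(`i + 1` is taken modulo `n + 1`). A loop is a cycle of length `1`, and two distinct parallel
edges form a cycle of length `2`. -/
structure IsCycle (G : Graph α β) {n : ℕ} (v : Fin (n + 1) → α) (e : Fin (n + 1) → β) : Prop where
  vertex_injective : Function.Injective v
  edge_injective : Function.Injective e
  isLink : ∀ i, G.IsLink (e i) (v i) (v (i + 1))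

/-- A tree is a connected graph without cycles. -/
def IsTree (G : Graph α β) : Prop :=
  G.IsConnected ∧ ∀ (n : ℕ) (v : Fin (n + 1) → α) (e : Fin (n + 1) → β), ¬ G.IsCycle v e

/-! ### Mixing involutions, quotients, hyperelliptic graphs -/

/-- The maps `σ` on vertices and `τ` on edges form an automorphism of `G` of order two
(their values outside of `V(G)` and `E(G)` are irrelevant), and every edge between `x` and `y`
which is fixed by `τ` satisfies `σ x = y`. -/
structure IsMixingInvolution (G : Graph α β) (σ : α → α) (τ : β → β) : Prop where
  vertex_mem : ∀ v ∈ V(G), σ v ∈ V(G)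
  isLink : ∀ e x y, G.IsLink e x y → G.IsLink (τ e) (σ x) (σ y)
  vertex_invol : ∀ v ∈ V(G), σ (σ v) = v
  edge_invol : ∀ e ∈ E(G), τ (τ e) = e
  ne_id : (∃ v ∈ V(G), σ v ≠ v) ∨ ∃ e ∈ E(G), τ e ≠ e
  mixing : ∀ e x y, G.IsLink e x y → τ e = e → σ x = y

theorem IsMixingInvolution.pair_eq {G : Graph α β} {σ : α → α} {τ : β → β}
    (h : G.IsMixingInvolution σ τ) {v : α} (hv : v ∈ V(G)) :
    ({σ v, σ (σ v)} : Set α) = {v, σ v} := by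
  rw [h.vertex_invol v hv, Set.pair_comm]

/-- The quotient of `G` by a mixing involution: its vertices are the sets `{v, σ v}` with `v` a
vertex of `G`, its edges are the sets `{e, τ e}` with `e` an edge of `G` between `x` and `y` with
`{x, σ x} ≠ {y, σ y}`, and such an edge joins `{x, σ x}` and `{y, σ y}`. -/
def quotientGraph (G : Graph α β) (σ : α → α) (τ : β → β) (h : G.IsMixingInvolution σ τ) :
    Graph (Set α) (Set β) where
  vertexSet := {X | ∃ v ∈ V(G), X = {v, σ v}}
  IsLink E X Y := ∃ e x y, G.IsLink e x y ∧ E = {e, τ e} ∧ X = {x, σ x} ∧ Y = {y, σ y} ∧ X ≠ Y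
  isLink_symm := by
    intro E _
    refine ⟨?_⟩
    rintro X Y ⟨e, x, y, hl, hE, hX, hY, hne⟩
    exact ⟨e, y, x, hl.symm, hE, hY, hX, hne.symm⟩
  eq_or_eq_of_isLink_of_isLink := by
    rintro E X Y X' Y' ⟨e, x, y, hl, rfl, rfl, rfl, -⟩ ⟨e', x', y', hl', hE, rfl, rfl, -⟩
    have he : e ∈ ({e', τ e'} : Set β) := hE ▸ Set.mem_insert e {τ e}
    rcases he with rfl | he
    · rcases hl.left_eq_or_eq hl' with rfl | rfl
      · exact Or.inl rfl
      · exact Or.inr rfl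
    · rw [Set.mem_singleton_iff] at he
      subst he
      rcases hl.left_eq_or_eq (h.isLink _ _ _ hl') with rfl | rfl
      · exact Or.inl (h.pair_eq hl'.left_mem)
      · exact Or.inr (h.pair_eq hl'.right_mem)
  left_mem_of_isLink := by
    rintro E X Y ⟨e, x, y, hl, -, hX, -, -⟩
    exact ⟨x, hl.left_mem, hX⟩

/-- `(σ, τ)` is a hyperelliptic involution of `G`: the graph `G` is connected, `(σ, τ)` is a mixing
involution of it, and the quotient is a tree. -/
def IsHyperellipticInvolution (G : Graph α β) (σ : α → α) (τ : β → β) : Prop :=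
  G.IsConnected ∧ ∃ h : G.IsMixingInvolution σ τ, (G.quotientGraph σ τ h).IsTree

/-- A graph is hyperelliptic if it admits a hyperelliptic involution. -/
def IsHyperelliptic (G : Graph α β) : Prop :=
  ∃ (σ : α → α) (τ : β → β), G.IsHyperellipticInvolution σ τ

/-! ### Embeddings in the plane -/

/-- An embedding of `G` in the plane `ℝ²` (for finite `G`): distinct vertices go to distinct
points, and each edge goes to a curve, parametrized by `[0, 1]`, which connects its two ends;
the interior of this curve has no self-intersection and meets neither the vertices nor
the interiors of the other edges. -/
structure PlaneEmbedding (G : Graph α β) where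
  pt : α → ℝ × ℝ
  arc : β → ℝ → ℝ × ℝ
  pt_injOn : InjOn pt V(G)
  arc_continuousOn : ∀ e ∈ E(G), ContinuousOn (arc e) (Icc 0 1)
  arc_ends : ∀ e ∈ E(G), ∃ x y, G.IsLink e x y ∧ arc e 0 = pt x ∧ arc e 1 = pt y
  arc_injOn : ∀ e ∈ E(G), InjOn (arc e) (Ioo 0 1)
  arc_ne_pt : ∀ e ∈ E(G), ∀ t ∈ Ioo (0 : ℝ) 1, ∀ v ∈ V(G), arc e t ≠ pt v
  arc_ne_arc : ∀ e ∈ E(G), ∀ e' ∈ E(G), e ≠ e' →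
    ∀ s ∈ Ioo (0 : ℝ) 1, ∀ t ∈ Ioo (0 : ℝ) 1, arc e s ≠ arc e' t

/-- A graph is planar if it has an embedding in the plane. -/
def IsPlanar (G : Graph α β) : Prop :=
  Nonempty G.PlaneEmbedding

namespace PlaneEmbedding

variable {G : Graph α β}

/-- The curve of the edge `e`, including its ends. -/
def curve (ρ : G.PlaneEmbedding) (e : β) : Set (ℝ × ℝ) :=
  ρ.arc e '' Icc 0 1

/-- The image of the graph in the plane. -/
def image (ρ : G.PlaneEmbedding) : Set (ℝ × ℝ) :=
  ρ.pt '' V(G) ∪ ⋃ e ∈ E(G), ρ.curve e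

/-- A face is a connected component of the complement of the image of the graph. -/
def IsFace (ρ : G.PlaneEmbedding) (F : Set (ℝ × ℝ)) : Prop :=
  ∃ p ∈ ρ.imageᶜ, F = connectedComponentIn ρ.imageᶜ p

/-- The vertices `v` and `w` lie on (the boundary of) a common face. -/
def OnCommonFace (ρ : G.PlaneEmbedding) (v w : α) : Prop :=
  ∃ F, ρ.IsFace F ∧ ρ.pt v ∈ frontier F ∧ ρ.pt w ∈ frontier F

/-- The reflection of the plane in the `y`-axis. -/
def reflect (p : ℝ × ℝ) : ℝ × ℝ :=
  (-p.1, p.2)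

/-- The embedding is symmetric under `(σ, τ)`: the reflection in the `y`-axis takes each vertex `v`
to `σ v` and each edge `e` to `τ e`, except that an edge between two distinct vertices `v` and
`σ v` is taken to itself. (The curve of such an edge crosses the axis and so meets its
mirror image, which therefore cannot be the curve of another edge; if `τ e = e` for all these
edges, then the exception is none.) -/
structure IsSymmetric (ρ : G.PlaneEmbedding) (σ : α → α) (τ : β → β) : Prop where
  pt_eq : ∀ v ∈ V(G), ρ.pt (σ v) = reflect (ρ.pt v)
  curve_eq : ∀ e x y, G.IsLink e x y → ¬ (x ≠ y ∧ σ x = y) →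
    ρ.curve (τ e) = reflect '' ρ.curve e
  curve_self_eq : ∀ e x y, G.IsLink e x y → x ≠ y → σ x = y →
    ρ.curve e = reflect '' ρ.curve e

end PlaneEmbedding

end Graph

namespace Graph

/-! ### Non-crossing heights on a rooted tree -/

/-- The nodes of a finite rooted tree, given by its parent function `p` and a rank function `k`, can
be put on a line such that each node comes after its parent and the arcs which join the nodes to
their parents do not cross. -/
theorem exists_noncrossing_height {N : Type*} (A : Finset N) (r : N) (p : N → N) (k : N → ℕ)
    (hp : ∀ n ∈ A, n ≠ r → p n ∈ A ∧ k (p n) < k n) :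
    ∃ h : N → ℤ, InjOn h A ∧ (∀ n ∈ A, n ≠ r → h (p n) < h n) ∧
      ∀ m ∈ A, ∀ n ∈ A, m ≠ r → n ≠ r → ¬ (h (p m) < h (p n) ∧ h (p n) < h m ∧ h m < h n) := by
  classical
  induction hc : A.card generalizing A with
  | zero =>
    rw [Finset.card_eq_zero] at hc
    subst hc
    exact ⟨fun _ ↦ 0, by simp, by simp, by simp⟩
  | succ c ih =>
    by_cases hA : (A.erase r).Nonempty
    · obtain ⟨n, hn, hmax⟩ := Finset.exists_max_image _ k hA
      obtain ⟨hnr, hnA⟩ := Finset.mem_erase.1 hn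
      have hpn : ∀ m ∈ A, m ≠ r → p m ≠ n := by
        rintro m hm hmr rfl
        exact absurd (hp m hm hmr).2 (not_lt.2 (hmax m (Finset.mem_erase.2 ⟨hmr, hm⟩)))
      obtain ⟨h, hinj, hlt, hcr⟩ := ih (A.erase n)
        (fun m hm hmr ↦ ⟨Finset.mem_erase.2 ⟨hpn m (Finset.mem_of_mem_erase hm) hmr,
          (hp m (Finset.mem_of_mem_erase hm) hmr).1⟩, (hp m (Finset.mem_of_mem_erase hm) hmr).2⟩)
        (by rw [Finset.card_erase_of_mem hnA, hc]; rfl)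
      have hne : ∀ m ∈ A, m ≠ n → m ∈ A.erase n := fun m hm h ↦ Finset.mem_erase.2 ⟨h, hm⟩
      have hold : ∀ m, m ≠ n → Function.update (fun m ↦ 2 * h m) n (2 * h (p n) + 1) m = 2 * h m :=
        fun m hm ↦ by rw [Function.update_of_ne hm]
      have hnew : Function.update (fun m ↦ 2 * h m) n (2 * h (p n) + 1) n = 2 * h (p n) + 1 := by
        rw [Function.update_self]
      refine ⟨Function.update (fun m ↦ 2 * h m) n (2 * h (p n) + 1), ?_, ?_, ?_⟩
      · intro x hx y hy hxy
        by_cases hxn : x = n <;> by_cases hyn : y = n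
        · rw [hxn, hyn]
        · subst hxn
          rw [hnew, hold y hyn] at hxy
          omega
        · subst hyn
          rw [hnew, hold x hxn] at hxy
          omega
        · rw [hold x hxn, hold y hyn] at hxy
          exact hinj (hne x hx hxn) (hne y hy hyn) (by omega)
      · intro m hm hmr
        rw [hold _ (hpn m hm hmr)]
        by_cases hmn : m = n
        · subst hmn
          rw [hnew]
          omega
        · rw [hold m hmn]
          have := hlt m (hne m hm hmn) hmr
          omega
      · intro x hx y hy hxr hyr
        rw [hold _ (hpn x hx hxr), hold _ (hpn y hy hyr)]
        by_cases hxn : x = n <;> by_cases hyn : y = n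
        · subst hxn hyn
          omega
        · subst hxn
          rw [hnew]
          omega
        · subst hyn
          rw [hnew, hold x hxn]
          omega
        · rw [hold x hxn, hold y hyn]
          have := hcr x (hne x hx hxn) y (hne y hy hyn) hxr hyr
          omega
    · have hr : ∀ n ∈ A, n = r := fun n hn ↦ by
        by_contra h
        exact hA ⟨n, Finset.mem_erase.2 ⟨h, hn⟩⟩
      refine ⟨fun _ ↦ 0, fun x hx y hy _ ↦ (hr x hx).trans (hr y hy).symm, ?_, ?_⟩
      · exact fun n hn hnr ↦ absurd (hr n hn) hnr
      · exact fun m hm n _ hmr ↦ absurd (hr m hm) hmr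

/-! ### Drawing arcs in a half plane -/

/-- The data for a drawing of a rooted tree in the half plane: the heights of the nodes, for which
the arcs from the nodes to their parents do not cross, and the set of the nodes which are to lie on
the boundary of the half plane. -/
structure ArcDiagram (N : Type*) where
  nodes : Finset N
  root : N
  parent : N → N
  height : N → ℤ
  axis : Finset N
  axis_subset : axis ⊆ nodes
  parent_mem : ∀ n ∈ nodes, n ≠ root → parent n ∈ nodes
  height_injOn : InjOn height nodes
  height_parent_lt : ∀ n ∈ nodes, n ≠ root → height (parent n) < height n
  noncrossing : ∀ m ∈ nodes, ∀ n ∈ nodes, m ≠ root → n ≠ root →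
    ¬ (height (parent m) < height (parent n) ∧ height (parent n) < height m ∧ height m < height n)

namespace ArcDiagram

variable {N : Type*} (L : ArcDiagram N)

/-- The distance from the axis, as a function of the height, of the curve that holds the nodes. -/
def width (y : ℝ) : ℝ :=
  ∏ z ∈ L.axis, (y - L.height z) ^ 2

theorem width_nonneg (y : ℝ) : 0 ≤ L.width y :=
  Finset.prod_nonneg fun _ _ ↦ sq_nonneg _

theorem continuous_width : Continuous L.width :=
  continuous_finsetProd _ fun _ _ ↦ by fun_prop

theorem width_height_eq_zero_iff {n : N} (hn : n ∈ L.nodes) :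
    L.width (L.height n) = 0 ↔ n ∈ L.axis := by
  rw [width, Finset.prod_eq_zero_iff]
  constructor
  · rintro ⟨z, hz, h⟩
    have h' : L.height n = L.height z := by
      have := pow_eq_zero_iff (two_ne_zero) |>.1 h
      exact_mod_cast sub_eq_zero.1 this
    rwa [L.height_injOn hn (L.axis_subset hz) h']
  · exact fun h ↦ ⟨n, h, by simp⟩

theorem width_height_pos {n : N} (hn : n ∈ L.nodes) (h : n ∉ L.axis) :
    0 < L.width (L.height n) :=
  lt_of_le_of_ne (L.width_nonneg _) fun h' ↦ h ((L.width_height_eq_zero_iff hn).1 h'.symm)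

/-- The distance from the axis, as a function of the height, of the arc of strength `c` between a
node and its parent. -/
noncomputable def bulge (n : N) (c y : ℝ) : ℝ :=
  L.width y + c * 2 ^ (L.height n - L.height (L.parent n)) *
    ((y - L.height (L.parent n)) * (L.height n - y))

theorem continuous_bulge (n : N) (c : ℝ) : Continuous (L.bulge n c) := by
  have := L.continuous_width
  unfold bulge
  fun_prop

theorem bulge_height (n : N) (c : ℝ) : L.bulge n c (L.height n) = L.width (L.height n) := by
  simp [bulge]

theorem bulge_height_parent (n : N) (c : ℝ) :
    L.bulge n c (L.height (L.parent n)) = L.width (L.height (L.parent n)) := by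
  simp [bulge]

theorem width_lt_bulge {n : N} {c y : ℝ} (hc : 0 < c)
    (hy : y ∈ Ioo (L.height (L.parent n) : ℝ) (L.height n)) : L.width y < L.bulge n c y := by
  have h1 := sub_pos.2 hy.1
  have h2 := sub_pos.2 hy.2
  have : (0 : ℝ) < c * 2 ^ (L.height n - L.height (L.parent n)) *
    ((y - L.height (L.parent n)) * (L.height n - y)) := by positivity
  unfold bulge
  linarith

theorem bulge_injective {n : N} {c c' y : ℝ}
    (hy : y ∈ Ioo (L.height (L.parent n) : ℝ) (L.height n))
    (h : L.bulge n c y = L.bulge n c' y) : c = c' := by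
  have h1 := sub_pos.2 hy.1
  have h2 := sub_pos.2 hy.2
  have h3 : (0 : ℝ) < 2 ^ (L.height n - L.height (L.parent n)) := by positivity
  unfold bulge at h
  rw [add_right_inj, mul_assoc, mul_assoc] at h
  exact mul_right_cancel₀ (by positivity) h

theorem bulge_nonneg {n : N} {c y : ℝ} (hc : 0 < c)
    (hy : y ∈ Ioc (L.height (L.parent n) : ℝ) (L.height n)) : 0 ≤ L.bulge n c y := by
  have h1 := sub_pos.2 hy.1
  have h2 := sub_nonneg.2 hy.2
  have : (0 : ℝ) ≤ c * 2 ^ (L.height n - L.height (L.parent n)) *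
    ((y - L.height (L.parent n)) * (L.height n - y)) := by positivity
  unfold bulge
  linarith [L.width_nonneg y]

/-- Arcs of different nodes do not meet. -/
theorem bulge_ne_of_height_lt {m n : N} (hm : m ∈ L.nodes) (hn : n ∈ L.nodes) (hmr : m ≠ L.root)
    (hnr : n ≠ L.root) (hlt : L.height m < L.height n) {c c' y : ℝ} (hc : c < 2)
    (hc' : 1 ≤ c') (hy : y ∈ Ioc (L.height (L.parent m) : ℝ) (L.height m))
    (hy' : y ∈ Ioc (L.height (L.parent n) : ℝ) (L.height n)) : L.bulge m c y < L.bulge n c' y := by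
  have hpn : L.height (L.parent n) < L.height m := by
    exact_mod_cast hy'.1.trans_le hy.2
  have hpm : L.height (L.parent n) ≤ L.height (L.parent m) := by
    by_contra h
    exact L.noncrossing m hm n hn hmr hnr ⟨not_le.1 h, hpn, hlt⟩
  have hpm' : (L.height (L.parent n) : ℝ) ≤ L.height (L.parent m) := by exact_mod_cast hpm
  have hlt' : (L.height m : ℝ) < L.height n := by exact_mod_cast hlt
  have h1 := sub_pos.2 hy.1
  have h2 := sub_nonneg.2 hy.2
  have hpow : (2 : ℝ) * 2 ^ (L.height m - L.height (L.parent m)) ≤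
      2 ^ (L.height n - L.height (L.parent n)) := by
    rw [← zpow_one_add₀ two_ne_zero]
    exact zpow_le_zpow_right₀ one_le_two (by omega)
  have hpos : (0 : ℝ) < 2 ^ (L.height m - L.height (L.parent m)) := by positivity
  have hprod : (y - L.height (L.parent m)) * (L.height m - y) <
      (y - L.height (L.parent n)) * (L.height n - y) :=
    calc (y - L.height (L.parent m)) * (L.height m - y)
        < (y - L.height (L.parent m)) * (L.height n - y) :=
          mul_lt_mul_of_pos_left (by linarith) h1
      _ ≤ _ := mul_le_mul_of_nonneg_right (by linarith) (by linarith)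
  have hprod0 : 0 ≤ (y - L.height (L.parent m)) * (L.height m - y) := mul_nonneg h1.le h2
  have hcoef : c * 2 ^ (L.height m - L.height (L.parent m)) ≤
      c' * 2 ^ (L.height n - L.height (L.parent n)) :=
    calc c * 2 ^ (L.height m - L.height (L.parent m))
        ≤ 2 * 2 ^ (L.height m - L.height (L.parent m)) := by gcongr
      _ ≤ 1 * 2 ^ (L.height n - L.height (L.parent n)) := by rwa [one_mul]
      _ ≤ _ := by gcongr
  have := mul_lt_mul' hcoef hprod hprod0 (by positivity)
  unfold bulge
  linarith

/-- The point at height `y` on the arc of strength `c` between a node and its parent, drawn in the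
right half plane for `s = 1` and in the left half plane for `s = -1`. -/
noncomputable def strand (n : N) (c s y : ℝ) : ℝ × ℝ :=
  (s * L.bulge n c y, y)

theorem continuous_strand (n : N) (c s : ℝ) : Continuous (L.strand n c s) :=
  (continuous_const.mul (L.continuous_bulge n c)).prodMk continuous_id

theorem reflect_strand (n : N) (c s y : ℝ) :
    PlaneEmbedding.reflect (L.strand n c s y) = L.strand n c (-s) y := by
  simp [PlaneEmbedding.reflect, strand]

theorem abs_sign_mul {s x : ℝ} (hs : s = 1 ∨ s = -1) (hx : 0 ≤ x) : |s * x| = x := by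
  rcases hs with rfl | rfl <;> simp [abs_of_nonneg hx]

theorem strand_eq_strand {m n : N} (hm : m ∈ L.nodes) (hn : n ∈ L.nodes) (hmr : m ≠ L.root)
    (hnr : n ≠ L.root) {c c' s s' y y' : ℝ} (hc : c ∈ Ico (1 : ℝ) 2) (hc' : c' ∈ Ico (1 : ℝ) 2)
    (hs : s = 1 ∨ s = -1) (hs' : s' = 1 ∨ s' = -1)
    (hy : y ∈ Ioc (L.height (L.parent m) : ℝ) (L.height m))
    (hy' : y' ∈ Ioc (L.height (L.parent n) : ℝ) (L.height n))
    (h : L.strand m c s y = L.strand n c' s' y') :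
    m = n ∧ y = y' ∧ (y < L.height m → c = c') ∧ (L.bulge m c y ≠ 0 → s = s') := by
  obtain ⟨hx, rfl⟩ : s * L.bulge m c y = s' * L.bulge n c' y' ∧ y = y' := Prod.mk.inj h
  have hc0 : 0 < c := zero_lt_one.trans_le hc.1
  have hc0' : 0 < c' := zero_lt_one.trans_le hc'.1
  have hb : L.bulge m c y = L.bulge n c' y := by
    rw [← abs_sign_mul hs (L.bulge_nonneg hc0 hy), hx,
      abs_sign_mul hs' (L.bulge_nonneg hc0' hy')]
  have hmn : m = n := by
    by_contra hne
    rcases lt_trichotomy (L.height m) (L.height n) with hlt | heq | hlt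
    · exact (L.bulge_ne_of_height_lt hm hn hmr hnr hlt hc.2 hc'.1 hy hy').ne hb
    · exact hne (L.height_injOn hm hn heq)
    · exact (L.bulge_ne_of_height_lt hn hm hnr hmr hlt hc'.2 hc.1 hy' hy).ne hb.symm
  subst hmn
  refine ⟨rfl, rfl, fun hlt ↦ L.bulge_injective ⟨hy.1, hlt⟩ hb, fun h0 ↦ ?_⟩
  rw [← hb] at hx
  exact mul_right_cancel₀ h0 hx

/-- The height which is reached at time `t` on the way from the parent of a node to the node. -/
noncomputable def level (n : N) (t : ℝ) : ℝ :=
  L.height (L.parent n) + t * (L.height n - L.height (L.parent n))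

theorem continuous_level (n : N) : Continuous (L.level n) := by
  unfold level
  fun_prop

theorem level_zero (n : N) : L.level n 0 = L.height (L.parent n) := by simp [level]

theorem level_one (n : N) : L.level n 1 = L.height n := by simp [level]

theorem level_mem_Ioc {n : N} (hn : n ∈ L.nodes) (hr : n ≠ L.root) {t : ℝ} (ht : t ∈ Ioc (0 : ℝ) 1) :
    L.level n t ∈ Ioc (L.height (L.parent n) : ℝ) (L.height n) := by
  have h : (L.height (L.parent n) : ℝ) < L.height n := by
    exact_mod_cast L.height_parent_lt n hn hr
  have h' := sub_pos.2 h
  constructor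
  · have := mul_pos ht.1 h'
    unfold level
    linarith
  · have := mul_le_mul_of_nonneg_right ht.2 h'.le
    unfold level
    linarith

theorem level_injective {n : N} (hn : n ∈ L.nodes) (hr : n ≠ L.root) :
    Function.Injective (L.level n) := by
  intro s t h
  have h' : (L.height (L.parent n) : ℝ) < L.height n := by
    exact_mod_cast L.height_parent_lt n hn hr
  exact mul_right_cancel₀ (sub_pos.2 h').ne' (add_left_cancel h)

theorem level_lt {n : N} (hn : n ∈ L.nodes) (hr : n ≠ L.root) {t : ℝ} (ht : t ∈ Ioo (0 : ℝ) 1) :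
    L.level n t < L.height n :=
  lt_of_le_of_ne (L.level_mem_Ioc hn hr ⟨ht.1, ht.2.le⟩).2 fun h ↦
    ht.2.ne (L.level_injective hn hr (h.trans (L.level_one n).symm))

/-- The curve from the parent of a node to the node along one arc and back along another one. -/
noncomputable def fold (n : N) (c s c' s' t : ℝ) : ℝ × ℝ :=
  if t ≤ 1 / 2 then L.strand n c s (L.level n (2 * t))
  else L.strand n c' s' (L.level n (2 * (1 - t)))

theorem fold_one_sub (n : N) (c s t : ℝ) (h : n ∈ L.axis) :
    L.fold n c s c (-s) (1 - t) = L.fold n c (-s) c s t := by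
  unfold fold
  rcases lt_trichotomy t (1 / 2) with ht | ht | ht
  · rw [if_neg (by linarith), if_pos ht.le]
    congr 2
    ring
  · subst ht
    rw [if_pos (by norm_num), if_pos le_rfl]
    have : L.bulge n c (L.height n) = 0 := by
      rw [bulge_height, L.width_height_eq_zero_iff (L.axis_subset h)]
      exact h
    norm_num [level_one, strand, this]
  · rw [if_pos (by linarith), if_neg (by linarith)]

theorem reflect_fold (n : N) (c s c' s' t : ℝ) :
    PlaneEmbedding.reflect (L.fold n c s c' s' t) = L.fold n c (-s) c' (-s') t := by
  unfold fold
  split_ifs <;> rw [reflect_strand]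

theorem continuous_fold {n : N} (c s c' s' : ℝ) (hn : n ∈ L.nodes) (h : n ∈ L.axis ∨ s = s') :
    Continuous (L.fold n c s c' s') := by
  refine Continuous.if_le ?_ ?_ continuous_id continuous_const ?_
  · exact (L.continuous_strand n c s).comp ((L.continuous_level n).comp (by fun_prop))
  · exact (L.continuous_strand n c' s').comp ((L.continuous_level n).comp (by fun_prop))
  · rintro t rfl
    norm_num [level_one, strand, bulge_height]
    rcases h with h | h
    · exact Or.inr ((L.width_height_eq_zero_iff hn).2 h)
    · exact Or.inl h

theorem exists_fold_eq (n : N) (c s c' s' : ℝ) {t : ℝ} (ht : t ∈ Ioo (0 : ℝ) 1) :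
    ∃ u ∈ Ioc (0 : ℝ) 1, ∃ d t', L.fold n c s c' s' t = L.strand n d t' (L.level n u) ∧
      (d = c ∧ t' = s ∧ t ≤ 1 / 2 ∧ u = 2 * t ∨ d = c' ∧ t' = s' ∧ 1 / 2 < t ∧ u = 2 * (1 - t)) := by
  unfold fold
  split_ifs with h
  · exact ⟨2 * t, ⟨by linarith [ht.1], by linarith⟩, c, s, rfl, Or.inl ⟨rfl, rfl, h, rfl⟩⟩
  · rw [not_le] at h
    exact ⟨2 * (1 - t), ⟨by linarith [ht.2], by linarith⟩, c', s', rfl,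
      Or.inr ⟨rfl, rfl, h, rfl⟩⟩

theorem fold_injOn {n : N} {c s c' s' : ℝ} (hn : n ∈ L.nodes) (hr : n ≠ L.root)
    (hc : c ∈ Ico (1 : ℝ) 2) (hc' : c' ∈ Ico (1 : ℝ) 2) (hs : s = 1 ∨ s = -1)
    (hs' : s' = 1 ∨ s' = -1) (h : c ≠ c' ∨ s ≠ s') : InjOn (L.fold n c s c' s') (Ioo 0 1) := by
  intro t ht t' ht' heq
  obtain ⟨u, hu, d, σ, h1, h2⟩ := L.exists_fold_eq n c s c' s' ht
  obtain ⟨u', hu', d', σ', h1', h2'⟩ := L.exists_fold_eq n c s c' s' ht'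
  rw [h1, h1'] at heq
  obtain ⟨-, hl, hd, hσ⟩ := L.strand_eq_strand hn hn hr hr
    (by rcases h2 with ⟨rfl, -⟩ | ⟨rfl, -⟩ <;> assumption)
    (by rcases h2' with ⟨rfl, -⟩ | ⟨rfl, -⟩ <;> assumption)
    (by rcases h2 with ⟨-, rfl, -⟩ | ⟨-, rfl, -⟩ <;> assumption)
    (by rcases h2' with ⟨-, rfl, -⟩ | ⟨-, rfl, -⟩ <;> assumption)
    (L.level_mem_Ioc hn hr hu) (L.level_mem_Ioc hn hr hu') heq
  have huu := L.level_injective hn hr hl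
  have key : u < 1 → d = d' ∧ σ = σ' := fun hu1 ↦ by
    have hlt := L.level_lt hn hr ⟨hu.1, hu1⟩
    refine ⟨hd hlt, hσ ?_⟩
    have hd0 : 0 < d := by
      rcases h2 with ⟨rfl, -⟩ | ⟨rfl, -⟩ <;> linarith [hc.1, hc'.1]
    have := L.width_lt_bulge hd0 ⟨(L.level_mem_Ioc hn hr hu).1, hlt⟩
    exact ((L.width_nonneg _).trans_lt this).ne'
  rcases h2 with ⟨rfl, rfl, ha, hb⟩ | ⟨rfl, rfl, ha, hb⟩ <;>
    rcases h2' with ⟨rfl, rfl, ha', hb'⟩ | ⟨rfl, rfl, ha', hb'⟩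
  · linarith
  · have := key (by linarith)
    tauto
  · have := key (by linarith)
    exact absurd this (by rintro ⟨rfl, rfl⟩; simp at h)
  · linarith

end ArcDiagram

end Graph

namespace Graph

variable {α β : Type*}

/-! ### Cycles through an edge -/

/-- An edge whose ends are joined by a chain which avoids the edge lies on a cycle. -/
theorem exists_isCycle_of_reflTransGen (T : Graph α β) {e : β} {x y : α} (he : T.IsLink e x y)
    (h : Relation.ReflTransGen (fun a b ↦ ∃ f, f ≠ e ∧ T.IsLink f a b) x y) :
    ∃ (n : ℕ) (v : Fin (n + 1) → α) (f : Fin (n + 1) → β), T.IsCycle v f := by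
  classical
  let S : SimpleGraph α := SimpleGraph.fromRel fun a b ↦ ∃ f, f ≠ e ∧ T.IsLink f a b
  have hS : ∀ a b, S.Adj a b → ∃ f, f ≠ e ∧ T.IsLink f a b := by
    intro a b hab
    rcases ((SimpleGraph.fromRel_adj _ _ _).1 hab).2 with h | ⟨f, hf, hl⟩
    · exact h
    · exact ⟨f, hf, hl.symm⟩
  have hr : S.Reachable x y := by
    clear he
    induction h with
    | refl => exact SimpleGraph.Reachable.refl _
    | @tail b c _ hbc ih =>
      by_cases hne : b = c
      · rwa [← hne]
      · have : S.Adj b c := (SimpleGraph.fromRel_adj _ _ _).2 ⟨hne, Or.inl hbc⟩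
        exact ih.trans this.reachable
  obtain ⟨w, hw⟩ := hr.exists_isPath
  have hv : Function.Injective fun i : Fin (w.length + 1) ↦ w.getVert i := by
    intro i j hij
    exact Fin.ext (hw.getVert_injOn (Nat.lt_succ_iff.1 i.2) (Nat.lt_succ_iff.1 j.2) hij)
  have hval : ∀ i : Fin (w.length + 1), i ≠ Fin.last _ → ((i + 1 : Fin _) : ℕ) = i + 1 :=
    fun i hi ↦ Fin.val_add_one_of_lt (Fin.lt_last_iff_ne_last.2 hi)
  have hf : ∀ i : Fin (w.length + 1), ∃ f,
      T.IsLink f (w.getVert i) (w.getVert (i + 1 : Fin _)) ∧ (f = e ↔ i = Fin.last _) := by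
    intro i
    by_cases hi : i = Fin.last _
    · subst hi
      refine ⟨e, ?_, by simp⟩
      simpa using he.symm
    · have hlt : (i : ℕ) < w.length := Fin.val_lt_last hi
      obtain ⟨f, hne, hl⟩ := hS _ _ (w.adj_getVert_succ hlt)
      refine ⟨f, ?_, by simp [hne, hi]⟩
      rwa [hval i hi]
  choose f hl hfe using hf
  refine ⟨w.length, fun i ↦ w.getVert i, f, hv, ?_, hl⟩
  intro i j hij
  by_cases hi : i = Fin.last _
  · rw [hi]
    exact ((hfe j).1 (hij ▸ (hfe i).2 hi)).symm
  · have hj : j ≠ Fin.last _ := fun hj ↦ hi ((hfe i).1 (hij ▸ (hfe j).2 hj))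
    have hli := hl i
    rw [hij] at hli
    rcases hli.eq_and_eq_or_eq_and_eq (hl j) with ⟨h1, -⟩ | ⟨h1, h2⟩
    · exact hv h1
    · have h1' := congrArg Fin.val (hv h1)
      have h2' := congrArg Fin.val (hv h2)
      rw [hval j hj] at h1'
      rw [hval i hi] at h2'
      omega

/-! ### Lifting the quotient tree -/

/-- A rooted tree in `G` whose set of vertices `verts` contains at most one vertex of each orbit
of `σ`: each vertex `n` other than the root is joined to its parent by the edge `edge n`. -/
structure LiftedTree (G : Graph α β) (σ : α → α) where
  verts : Finset α
  root : α
  parent : α → α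
  rank : α → ℕ
  edge : α → β
  subset : ∀ v ∈ verts, v ∈ V(G)
  root_mem : root ∈ verts
  fixed : ∀ v ∈ verts, σ v ∈ verts → σ v = v
  parent_mem : ∀ v ∈ verts, v ≠ root → parent v ∈ verts
  rank_lt : ∀ v ∈ verts, v ≠ root → rank (parent v) < rank v
  isLink : ∀ v ∈ verts, v ≠ root → G.IsLink (edge v) v (parent v)

/-- The lifted tree meets all orbits. -/
def LiftedTree.IsSpanning {G : Graph α β} {σ : α → α} (T : G.LiftedTree σ) : Prop :=
  ∀ v ∈ V(G), v ∈ T.verts ∨ σ v ∈ T.verts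

theorem LiftedTree.eq_of_mem {G : Graph α β} {σ : α → α} (T : G.LiftedTree σ) {v w : α}
    (hv : v ∈ T.verts) (hw : w ∈ T.verts) (h : w = v ∨ w = σ v) : w = v := by
  rcases h with rfl | rfl
  · rfl
  · exact T.fixed v hv hw

variable {G : Graph α β} {σ : α → α} {τ : β → β}

theorem LiftedTree.exists_larger (hG : G.IsConnected) (hσ : G.IsMixingInvolution σ τ)
    (T : G.LiftedTree σ) (hT : ¬ T.IsSpanning) :
    ∃ T' : G.LiftedTree σ, T'.verts.card = T.verts.card + 1 := by
  classical
  have hadj : ∃ x ∈ T.verts, ∃ y e, G.IsLink e x y ∧ y ∉ T.verts ∧ σ y ∉ T.verts := by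
    by_contra! hno
    refine hT fun v hv ↦ ?_
    induction hG.2 T.root (T.subset _ T.root_mem) v hv with
    | refl => exact Or.inl T.root_mem
    | @tail b c _ hbc ih =>
      obtain ⟨e, he⟩ := hbc
      rcases ih he.left_mem with h | h
      · exact or_iff_not_imp_left.2 (hno b h c e he)
      · have := hno (σ b) h (σ c) (τ e) (hσ.isLink _ _ _ he)
        rw [hσ.vertex_invol c hv] at this
        exact (or_iff_not_imp_left.2 this).symm
  obtain ⟨x, hx, y, e, he, hy, hy'⟩ := hadj
  have hyV := he.right_mem
  have hxy : x ≠ y := by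
    rintro rfl
    exact hy hx
  have hne : ∀ v ∈ T.verts, v ≠ y := by
    rintro v hv rfl
    exact hy hv
  refine ⟨⟨insert y T.verts, T.root, Function.update T.parent y x,
    Function.update T.rank y (T.rank x + 1), Function.update T.edge y e,
    ?_, Finset.mem_insert_of_mem T.root_mem, ?_, ?_, ?_, ?_⟩, Finset.card_insert_of_notMem hy⟩
  · intro v hv
    rcases Finset.mem_insert.1 hv with rfl | hv
    · exact hyV
    · exact T.subset v hv
  · intro v hv hv'
    rcases Finset.mem_insert.1 hv with rfl | hv
    · exact (Finset.mem_insert.1 hv').resolve_right hy'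
    · rcases Finset.mem_insert.1 hv' with h | hv'
      · rw [← h, hσ.vertex_invol v (T.subset v hv)] at hy'
        exact absurd hv hy'
      · exact T.fixed v hv hv'
  · intro v hv hvr
    rcases Finset.mem_insert.1 hv with rfl | hv
    · rw [Function.update_self]
      exact Finset.mem_insert_of_mem hx
    · rw [Function.update_of_ne (hne v hv)]
      exact Finset.mem_insert_of_mem (T.parent_mem v hv hvr)
  · intro v hv hvr
    rcases Finset.mem_insert.1 hv with rfl | hv
    · rw [Function.update_self, Function.update_self, Function.update_of_ne hxy]
      exact Nat.lt_succ_self _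
    · rw [Function.update_of_ne (hne v hv), Function.update_of_ne (hne v hv),
        Function.update_of_ne (hne _ (T.parent_mem v hv hvr))]
      exact T.rank_lt v hv hvr
  · intro v hv hvr
    rcases Finset.mem_insert.1 hv with rfl | hv
    · rw [Function.update_self, Function.update_self]
      exact he.symm
    · rw [Function.update_of_ne (hne v hv), Function.update_of_ne (hne v hv)]
      exact T.isLink v hv hvr

theorem exists_liftedTree_isSpanning (hV : V(G).Finite) (hE : E(G).Nonempty)
    (hG : G.IsConnected) (hσ : G.IsMixingInvolution σ τ) : ∃ T : G.LiftedTree σ, T.IsSpanning := by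
  classical
  by_contra! hno
  have hcard : ∀ m : ℕ, ∃ T : G.LiftedTree σ, T.verts.card = m + 1 := by
    intro m
    induction m with
    | zero =>
      obtain ⟨r, hr⟩ := hG.1
      exact ⟨⟨{r}, r, id, fun _ ↦ 0, fun _ ↦ hE.some, by simpa using hr, by simp, by simp,
        by simp, by simp, by simp⟩, by simp⟩
    | succ m ih =>
      obtain ⟨T, hT⟩ := ih
      obtain ⟨T', hT'⟩ := T.exists_larger hG hσ (hno T)
      exact ⟨T', by omega⟩
  obtain ⟨T, hT⟩ := hcard hV.toFinset.card
  have := Finset.card_le_card fun v hv ↦ hV.mem_toFinset.2 (T.subset v hv)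
  omega

theorem IsMixingInvolution.edgeSet_nonempty (hσ : G.IsMixingInvolution σ τ)
    (hG : G.IsConnected) : E(G).Nonempty := by
  rcases hσ.ne_id with ⟨v, hv, hne⟩ | ⟨e, he, -⟩
  · rcases Relation.ReflTransGen.cases_head (hG.2 v hv _ (hσ.vertex_mem v hv)) with h | ⟨w, ⟨e, he⟩, -⟩
    · exact absurd h.symm hne
    · exact ⟨e, he.edge_mem⟩
  · exact ⟨e, he⟩

/-- If the quotient is a tree, then each edge of `G` between different orbits is an edge of the
lifted tree or the image of one. -/
theorem LiftedTree.exists_edge_eq (hσ : G.IsMixingInvolution σ τ)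
    (hT : (G.quotientGraph σ τ hσ).IsTree) (T : G.LiftedTree σ) (hsp : T.IsSpanning)
    {e : β} {x y : α} (he : G.IsLink e x y) (hxy : y ≠ x) (hxy' : σ x ≠ y) :
    ∃ n ∈ T.verts, n ≠ T.root ∧ (e = T.edge n ∨ e = τ (T.edge n)) := by
  by_contra! hno
  have horb : ∀ v ∈ T.verts, Relation.ReflTransGen
      (fun a b ↦ ∃ f, f ≠ ({e, τ e} : Set β) ∧ (G.quotientGraph σ τ hσ).IsLink f a b)
      {v, σ v} {T.root, σ T.root} := by
    intro v
    induction hk : T.rank v using Nat.strong_induction_on generalizing v with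
    | _ k ih =>
      intro hv
      by_cases hvr : v = T.root
      · rw [hvr]
      · refine Relation.ReflTransGen.head ?_
          (ih _ (hk ▸ T.rank_lt v hv hvr) _ rfl (T.parent_mem v hv hvr))
        refine ⟨{T.edge v, τ (T.edge v)}, ?_, T.edge v, v, T.parent v, T.isLink v hv hvr, rfl, rfl,
          rfl, ?_⟩
        · intro h
          have : e ∈ ({T.edge v, τ (T.edge v)} : Set β) := h ▸ mem_insert e _
          rcases this with h | h
          · exact (hno v hv hvr).1 h
          · exact (hno v hv hvr).2 h
        · intro h
          have hmem : T.parent v ∈ ({v, σ v} : Set α) := h ▸ mem_insert _ _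
          have := T.eq_of_mem hv (T.parent_mem v hv hvr) hmem
          exact absurd (T.rank_lt v hv hvr) (by rw [this]; exact lt_irrefl _)
  have hall : ∀ v ∈ V(G), Relation.ReflTransGen
      (fun a b ↦ ∃ f, f ≠ ({e, τ e} : Set β) ∧ (G.quotientGraph σ τ hσ).IsLink f a b)
      {v, σ v} {T.root, σ T.root} := by
    intro v hv
    rcases hsp v hv with h | h
    · exact horb v h
    · rw [← hσ.pair_eq hv]
      exact horb (σ v) h
  have hsymm : Std.Symm
      (fun a b ↦ ∃ f, f ≠ ({e, τ e} : Set β) ∧ (G.quotientGraph σ τ hσ).IsLink f a b) :=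
    ⟨fun a b ⟨f, hf, hl⟩ ↦ ⟨f, hf, hl.symm⟩⟩
  have hlink : (G.quotientGraph σ τ hσ).IsLink {e, τ e} {x, σ x} {y, σ y} := by
    refine ⟨e, x, y, he, rfl, rfl, rfl, fun h ↦ ?_⟩
    have : y ∈ ({x, σ x} : Set α) := h ▸ mem_insert y _
    rcases this with h | h
    · exact hxy h
    · exact hxy' h.symm
  obtain ⟨n, v, f, hc⟩ := exists_isCycle_of_reflTransGen _ hlink
    ((hall x he.left_mem).trans
      (Relation.ReflTransGen.stdSymm.symm _ _ (hall y he.right_mem)))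
  exact hT.2 n v f hc

end Graph

namespace Graph

variable {α β : Type*}

/-! ### The curves of a drawing -/

theorem exists_arcDiagram {N : Type*} (A B : Finset N) (hB : B ⊆ A) (r : N) (p : N → N) (k : N → ℕ)
    (hp : ∀ n ∈ A, n ≠ r → p n ∈ A ∧ k (p n) < k n) :
    ∃ L : ArcDiagram N, L.nodes = A ∧ L.axis = B ∧ L.root = r ∧ L.parent = p := by
  obtain ⟨h, h1, h2, h3⟩ := exists_noncrossing_height A r p k hp
  exact ⟨⟨A, r, p, h, B, hB, fun n hn hr ↦ (hp n hn hr).1, h1, h2, h3⟩, rfl, rfl, rfl, rfl⟩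

namespace ArcDiagram

variable (L : ArcDiagram (α ⊕ β))

open Classical in
/-- The curve of a node and a side: a single arc for a node on the left of the sum type, and for
a node on the right of it a symmetric closed curve or a curve around the node. -/
noncomputable def draw : α ⊕ β → ℝ → ℝ → ℝ × ℝ
  | .inl v, s, t => L.strand (.inl v) 1 s (L.level (.inl v) t)
  | .inr e, s, t => if .inr e ∈ L.axis then L.fold (.inr e) 1 1 1 (-1) t
      else L.fold (.inr e) 1 s (3 / 2) s t

theorem draw_inl (v : α) (s t : ℝ) :
    L.draw (.inl v) s t = L.strand (.inl v) 1 s (L.level (.inl v) t) := rfl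

theorem draw_inr_of_mem {e : β} (h : .inr e ∈ L.axis) (s : ℝ) :
    L.draw (.inr e) s = L.fold (.inr e) 1 1 1 (-1) := by
  funext t
  simp [draw, h]

theorem draw_inr_of_notMem {e : β} (h : .inr e ∉ L.axis) (s : ℝ) :
    L.draw (.inr e) s = L.fold (.inr e) 1 s (3 / 2) s := by
  funext t
  simp [draw, h]

variable {L}

theorem continuous_draw {n : α ⊕ β} (hn : n ∈ L.nodes) (s : ℝ) : Continuous (L.draw n s) := by
  rcases n with v | e
  · exact (L.continuous_strand _ _ _).comp (L.continuous_level _)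
  · by_cases h : .inr e ∈ L.axis
    · rw [draw_inr_of_mem L h]
      exact L.continuous_fold _ _ _ _ hn (Or.inl h)
    · rw [draw_inr_of_notMem L h]
      exact L.continuous_fold _ _ _ _ hn (Or.inr rfl)

theorem draw_injOn {n : α ⊕ β} (hn : n ∈ L.nodes) (hr : n ≠ L.root) {s : ℝ}
    (hs : s = 1 ∨ s = -1) : InjOn (L.draw n s) (Ioo 0 1) := by
  rcases n with v | e
  · intro t _ t' _ h
    exact L.level_injective hn hr (Prod.mk.inj h).2
  · by_cases h : .inr e ∈ L.axis
    · rw [draw_inr_of_mem L h]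
      exact L.fold_injOn hn hr (by norm_num) (by norm_num) (by norm_num) (by norm_num)
        (by norm_num)
    · rw [draw_inr_of_notMem L h]
      exact L.fold_injOn hn hr (by norm_num) (by norm_num) hs hs (by norm_num)

theorem exists_draw_eq_strand {n : α ⊕ β} (hn : n ∈ L.nodes) (hr : n ≠ L.root) {s t : ℝ}
    (hs : s = 1 ∨ s = -1) (ht : t ∈ Ioo (0 : ℝ) 1) :
    ∃ c ∈ Ico (1 : ℝ) 2, ∃ s', (s' = 1 ∨ s' = -1) ∧
      ∃ y ∈ Ioc (L.height (L.parent n) : ℝ) (L.height n), L.draw n s t = L.strand n c s' y ∧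
        (y < L.height n ∨ n.isRight) ∧ (s' = s ∨ n.isRight ∧ n ∈ L.axis) := by
  rcases n with v | e
  · exact ⟨1, by norm_num, s, hs, _, L.level_mem_Ioc hn hr ⟨ht.1, ht.2.le⟩, rfl,
      Or.inl (L.level_lt hn hr ht), Or.inl rfl⟩
  · by_cases h : .inr e ∈ L.axis
    · rw [draw_inr_of_mem L h]
      obtain ⟨u, hu, d, s', heq, h2⟩ := L.exists_fold_eq (.inr e) 1 1 1 (-1) ht
      refine ⟨d, ?_, s', ?_, _, L.level_mem_Ioc hn hr hu, heq, Or.inr rfl, Or.inr ⟨rfl, h⟩⟩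
      · rcases h2 with ⟨rfl, -⟩ | ⟨rfl, -⟩ <;> norm_num
      · tauto
    · rw [draw_inr_of_notMem L h]
      obtain ⟨u, hu, d, s', heq, h2⟩ := L.exists_fold_eq (.inr e) 1 s (3 / 2) s ht
      refine ⟨d, ?_, s', ?_, _, L.level_mem_Ioc hn hr hu, heq, Or.inr rfl, ?_⟩
      · rcases h2 with ⟨rfl, -⟩ | ⟨rfl, -⟩ <;> norm_num
      · rcases h2 with ⟨-, rfl, -⟩ | ⟨-, rfl, -⟩ <;> exact hs
      · tauto

theorem draw_eq_draw {m n : α ⊕ β} (hm : m ∈ L.nodes) (hn : n ∈ L.nodes) (hmr : m ≠ L.root)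
    (hnr : n ≠ L.root) {s s' t t' : ℝ} (hs : s = 1 ∨ s = -1) (hs' : s' = 1 ∨ s' = -1)
    (ht : t ∈ Ioo (0 : ℝ) 1) (ht' : t' ∈ Ioo (0 : ℝ) 1) (h : L.draw m s t = L.draw n s' t') :
    m = n ∧ (s = s' ∨ m.isRight ∧ m ∈ L.axis) := by
  obtain ⟨c, hc, r, hr, y, hy, heq, h1, h2⟩ := exists_draw_eq_strand hm hmr hs ht
  obtain ⟨c', hc', r', hr', y', hy', heq', -, h2'⟩ := exists_draw_eq_strand hn hnr hs' ht'
  rw [heq, heq'] at h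
  obtain ⟨rfl, rfl, -, hrr⟩ := L.strand_eq_strand hm hn hmr hnr hc hc' hr hr' hy hy' h
  refine ⟨rfl, or_iff_not_imp_right.2 fun hax ↦ ?_⟩
  obtain rfl := h2.resolve_right hax
  obtain rfl := h2'.resolve_right hax
  refine hrr (ne_of_gt ?_)
  have hc0 : 0 < c := zero_lt_one.trans_le hc.1
  by_cases hlt : y < L.height m
  · exact (L.width_nonneg y).trans_lt (L.width_lt_bulge hc0 ⟨hy.1, hlt⟩)
  · have hyh : y = L.height m := le_antisymm hy.2 (not_lt.1 hlt)
    rw [hyh, bulge_height]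
    exact L.width_height_pos hm fun hax' ↦ hax ⟨h1.resolve_left hlt, hax'⟩

/-- The strip between the curve that holds the nodes and its mirror image contains no inner
point of a curve at the height of a node on the left of the sum type. -/
theorem width_lt_abs_of_draw {n : α ⊕ β} (hn : n ∈ L.nodes) (hr : n ≠ L.root) {s t : ℝ}
    (hs : s = 1 ∨ s = -1) (ht : t ∈ Ioo (0 : ℝ) 1) {v : α} (hv : .inl v ∈ L.nodes)
    (h : (L.draw n s t).2 = L.height (.inl v)) :
    L.width (L.height (.inl v)) < |(L.draw n s t).1| := by
  obtain ⟨c, hc, r, hr, y, hy, heq, h1, -⟩ := exists_draw_eq_strand hn hr hs ht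
  rw [heq] at h ⊢
  change y = _ at h
  have hc0 : 0 < c := zero_lt_one.trans_le hc.1
  change _ < |r * L.bulge n c y|
  rw [abs_sign_mul hr (L.bulge_nonneg hc0 hy), ← h]
  refine L.width_lt_bulge hc0 ⟨hy.1, lt_of_le_of_ne hy.2 fun h' ↦ ?_⟩
  rw [h'] at h
  have := L.height_injOn hn hv (by exact_mod_cast h)
  subst this
  exact absurd h' (h1.resolve_right (by simp)).ne

theorem reflect_draw (n : α ⊕ β) (s t : ℝ) (h : ¬ (n.isRight ∧ n ∈ L.axis)) :
    PlaneEmbedding.reflect (L.draw n s t) = L.draw n (-s) t := by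
  rcases n with v | e
  · exact L.reflect_strand _ _ _ _
  · have h : .inr e ∉ L.axis := fun h' ↦ h ⟨rfl, h'⟩
    rw [draw_inr_of_notMem L h, draw_inr_of_notMem L h]
    exact L.reflect_fold _ _ _ _ _ _

theorem draw_one_sub {e : β} (h : .inr e ∈ L.axis) (s t : ℝ) :
    L.draw (.inr e) s (1 - t) = PlaneEmbedding.reflect (L.draw (.inr e) s t) := by
  rw [draw_inr_of_mem L h, reflect_fold, fold_one_sub L _ _ _ _ h, neg_neg]

/-- The point of the node `v`, on the side `s`. -/
noncomputable def point (L : ArcDiagram (α ⊕ β)) (v : α) (s : ℝ) : ℝ × ℝ :=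
  (s * L.width (L.height (.inl v)), L.height (.inl v))

theorem reflect_point (v : α) (s : ℝ) :
    PlaneEmbedding.reflect (L.point v s) = L.point v (-s) := by
  simp [PlaneEmbedding.reflect, point]

theorem draw_inl_zero {v w : α} (h : L.parent (.inl v) = .inl w) (s : ℝ) :
    L.draw (.inl v) s 0 = L.point w s := by
  rw [draw_inl, level_zero, strand, bulge_height_parent, h, point]

theorem draw_inl_one (v : α) (s : ℝ) : L.draw (.inl v) s 1 = L.point v s := by
  rw [draw_inl, level_one, strand, bulge_height, point]

theorem fold_zero {e : β} {w : α} (h : L.parent (.inr e) = .inl w) (c s c' s' : ℝ) :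
    L.fold (.inr e) c s c' s' 0 = L.point w s := by
  rw [fold, if_pos (by norm_num), mul_zero, level_zero, strand, bulge_height_parent, h, point]

theorem fold_one {e : β} {w : α} (h : L.parent (.inr e) = .inl w) (c s c' s' : ℝ) :
    L.fold (.inr e) c s c' s' 1 = L.point w s' := by
  rw [fold, if_neg (by norm_num), sub_self, mul_zero, level_zero, strand, bulge_height_parent, h,
    point]

end ArcDiagram

end Graph

namespace Graph

variable {α β : Type*}

/-! ### The drawing of a hyperelliptic graph -/

/-- The edges which have to cross the axis of the reflection: those between distinct vertices `x`
and `σ x`, and the loops fixed by `τ`. -/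
def IsCrossing (G : Graph α β) (σ : α → α) (τ : β → β) (e : β) : Prop :=
  ∃ x y, G.IsLink e x y ∧ σ x = y ∧ (x ≠ y ∨ τ e = e)

/-- The data for a symmetric drawing of `G`: a lifted tree, an arc diagram whose nodes are the
vertices of this tree and, as leaves, the edges of `G`, and a choice `half` of one loop of each
pair of loops swapped by `τ`. -/
structure MirrorDiagram (G : Graph α β) (σ : α → α) (τ : β → β) where
  mixing : G.IsMixingInvolution σ τ
  tree : G.LiftedTree σ
  spanning : tree.IsSpanning
  edge_eq : ∀ e x y, G.IsLink e x y → y ≠ x → σ x ≠ y →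
    ∃ n ∈ tree.verts, n ≠ tree.root ∧ (e = tree.edge n ∨ e = τ (tree.edge n))
  foot : β → α
  foot_mem : ∀ e ∈ E(G), foot e ∈ tree.verts
  foot_eq : ∀ e ∈ E(G), ∃ x y, G.IsLink e x y ∧ (foot e = x ∨ foot e = σ x)
  half : Set β
  half_link : ∀ e ∈ half, ∃ x ∈ tree.verts, G.IsLink e x x
  half_not_crossing : ∀ e ∈ half, ¬ G.IsCrossing σ τ e
  half_mirror : ∀ e ∈ half, τ e ∉ half
  mem_half : ∀ e x, G.IsLink e x x → ¬ G.IsCrossing σ τ e → e ∈ half ∨ τ e ∈ half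
  diagram : ArcDiagram (α ⊕ β)
  inl_mem : ∀ v, .inl v ∈ diagram.nodes ↔ v ∈ tree.verts
  inr_mem : ∀ e, .inr e ∈ diagram.nodes ↔ e ∈ E(G)
  root_eq : diagram.root = .inl tree.root
  parent_inl : ∀ v, diagram.parent (.inl v) = .inl (tree.parent v)
  parent_inr : ∀ e, diagram.parent (.inr e) = .inl (foot e)
  inl_mem_axis : ∀ v ∈ tree.verts, .inl v ∈ diagram.axis ↔ σ v = v
  inr_mem_axis : ∀ e ∈ E(G), .inr e ∈ diagram.axis ↔ G.IsCrossing σ τ e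

variable {G : Graph α β} {σ : α → α} {τ : β → β}

theorem IsMixingInvolution.edge_mem (hσ : G.IsMixingInvolution σ τ) {e : β} (he : e ∈ E(G)) :
    τ e ∈ E(G) := by
  obtain ⟨x, y, hl⟩ := exists_isLink_of_mem_edgeSet he
  exact (hσ.isLink _ _ _ hl).edge_mem

theorem IsCrossing.edge_mem {e : β} (h : G.IsCrossing σ τ e) : e ∈ E(G) := by
  obtain ⟨x, y, hl, -⟩ := h
  exact hl.edge_mem

theorem IsCrossing.map (hσ : G.IsMixingInvolution σ τ) {e : β} (h : G.IsCrossing σ τ e) :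
    G.IsCrossing σ τ (τ e) := by
  obtain ⟨x, y, hl, hxy, h⟩ := h
  refine ⟨σ x, σ y, hσ.isLink _ _ _ hl, by rw [hxy], h.imp (fun h h' ↦ h ?_) (fun h ↦ by rw [h, h])⟩
  rw [← hσ.vertex_invol x hl.left_mem, h', hσ.vertex_invol y hl.right_mem]

theorem IsCrossing.map_iff (hσ : G.IsMixingInvolution σ τ) {e : β} (he : e ∈ E(G)) :
    G.IsCrossing σ τ (τ e) ↔ G.IsCrossing σ τ e := by
  refine ⟨fun h ↦ ?_, fun h ↦ h.map hσ⟩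
  have := h.map hσ
  rwa [hσ.edge_invol e he] at this

/-- The ends of a crossing edge are swapped by the involution. -/
theorem IsCrossing.map_eq (hσ : G.IsMixingInvolution σ τ) {e : β} (h : G.IsCrossing σ τ e)
    {x y : α} (hl : G.IsLink e x y) : σ x = y := by
  obtain ⟨a, b, hab, hσa, -⟩ := h
  rcases hl.eq_and_eq_or_eq_and_eq hab with ⟨rfl, rfl⟩ | ⟨rfl, rfl⟩
  · exact hσa
  · rw [← hσa, hσ.vertex_invol y hab.left_mem]

theorem exists_half_loops (hE : E(G).Finite) (hσ : G.IsMixingInvolution σ τ)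
    (T : G.LiftedTree σ) (hT : T.IsSpanning) :
    ∃ P : Set β, (∀ e ∈ P, ∃ x ∈ T.verts, G.IsLink e x x) ∧ (∀ e ∈ P, ¬ G.IsCrossing σ τ e) ∧
      (∀ e ∈ P, τ e ∉ P) ∧
      ∀ e x, G.IsLink e x x → ¬ G.IsCrossing σ τ e → e ∈ P ∨ τ e ∈ P := by
  obtain ⟨f, hf⟩ := countable_iff_exists_injOn.1 hE.countable
  refine ⟨{e | ∃ x ∈ T.verts, G.IsLink e x x ∧ ¬ G.IsCrossing σ τ e ∧ (σ x = x → f e < f (τ e))},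
    ?_, ?_, ?_, ?_⟩
  · rintro e ⟨x, hx, hl, -⟩
    exact ⟨x, hx, hl⟩
  · rintro e ⟨x, hx, hl, hc, -⟩
    exact hc
  · rintro e ⟨x, hx, hl, -, hlt⟩ ⟨y, hy, hl', -, hlt'⟩
    have hxy : y = σ x := by
      rcases (hσ.isLink _ _ _ hl).left_eq_or_eq hl' with h | h <;> exact h.symm
    subst hxy
    have hfix := T.fixed x hx hy
    rw [hσ.edge_invol e hl.edge_mem] at hlt'
    exact lt_asymm (hlt hfix) (hlt' (by rw [hfix, hfix]))
  · intro e x hl hc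
    have hl' := hσ.isLink _ _ _ hl
    have hc' : ¬ G.IsCrossing σ τ (τ e) := by rwa [IsCrossing.map_iff hσ hl.edge_mem]
    by_cases hfix : σ x = x
    · have hx : x ∈ T.verts := by
        have := hT x hl.left_mem
        rwa [hfix, or_self] at this
      have hne : e ≠ τ e := fun h ↦ hc ⟨x, x, hl, hfix, Or.inr h.symm⟩
      rw [hfix] at hl'
      rcases lt_or_gt_of_ne (hf.ne hl.edge_mem hl'.edge_mem hne) with h | h
      · exact Or.inl ⟨x, hx, hl, hc, fun _ ↦ h⟩
      · exact Or.inr ⟨x, hx, hl', hc', fun _ ↦ by rwa [hσ.edge_invol e hl.edge_mem]⟩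
    · rcases hT x hl.left_mem with hx | hx
      · exact Or.inl ⟨x, hx, hl, hc, fun h ↦ absurd h hfix⟩
      · refine Or.inr ⟨σ x, hx, hl', hc', fun h ↦ absurd ?_ hfix⟩
        rw [← h, hσ.vertex_invol x hl.left_mem]

theorem exists_mirrorDiagram (hV : V(G).Finite) (hE : E(G).Finite)
    (h : G.IsHyperellipticInvolution σ τ) : Nonempty (G.MirrorDiagram σ τ) := by
  classical
  obtain ⟨hG, hσ, htree⟩ := h
  obtain ⟨T, hT⟩ := exists_liftedTree_isSpanning hV (hσ.edgeSet_nonempty hG) hG hσ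
  obtain ⟨P, hP1, hP2, hP3, hP4⟩ := exists_half_loops hE hσ T hT
  have hfoot : ∀ e, ∃ z, e ∈ E(G) → z ∈ T.verts ∧ ∃ x y, G.IsLink e x y ∧ (z = x ∨ z = σ x) := by
    intro e
    by_cases he : e ∈ E(G)
    · obtain ⟨x, y, hl⟩ := exists_isLink_of_mem_edgeSet he
      rcases hT x hl.left_mem with hx | hx
      · exact ⟨x, fun _ ↦ ⟨hx, x, y, hl, Or.inl rfl⟩⟩
      · exact ⟨σ x, fun _ ↦ ⟨hx, x, y, hl, Or.inr rfl⟩⟩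
    · exact ⟨T.root, fun h ↦ absurd h he⟩
  choose q hq using hfoot
  obtain ⟨L, hL1, hL2, hL3, hL4⟩ := exists_arcDiagram (T.verts.disjSum hE.toFinset)
    ((T.verts.filter fun v ↦ σ v = v).disjSum (hE.toFinset.filter fun e ↦ G.IsCrossing σ τ e))
    (Finset.disjSum_mono (Finset.filter_subset _ _) (Finset.filter_subset _ _))
    (.inl T.root) (Sum.elim (fun v ↦ .inl (T.parent v)) (fun e ↦ .inl (q e)))
    (Sum.elim T.rank (fun e ↦ T.rank (q e) + 1)) (by
      rintro (v | e) hn hr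
      · have hv := Finset.inl_mem_disjSum.1 hn
        have hvr : v ≠ T.root := fun h ↦ hr (by rw [h])
        exact ⟨Finset.inl_mem_disjSum.2 (T.parent_mem v hv hvr), T.rank_lt v hv hvr⟩
      · have he := hE.mem_toFinset.1 (Finset.inr_mem_disjSum.1 hn)
        exact ⟨Finset.inl_mem_disjSum.2 (hq e he).1, Nat.lt_succ_self _⟩)
  exact ⟨{
    mixing := hσ
    tree := T
    spanning := hT
    edge_eq := fun e x y hl h1 h2 ↦ T.exists_edge_eq hσ htree hT hl h1 h2
    foot := q
    foot_mem := fun e he ↦ (hq e he).1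
    foot_eq := fun e he ↦ (hq e he).2
    half := P
    half_link := hP1
    half_not_crossing := hP2
    half_mirror := hP3
    mem_half := hP4
    diagram := L
    inl_mem := by simp [hL1]
    inr_mem := by simp [hL1]
    root_eq := hL3
    parent_inl := by simp [hL4]
    parent_inr := by simp [hL4]
    inl_mem_axis := by
      intro v hv
      simp [hL2, hv]
    inr_mem_axis := by
      intro e he
      simp [hL2, he] }⟩

namespace MirrorDiagram

variable (D : G.MirrorDiagram σ τ)

/-- The edge `e` is to be drawn as the curve of the node `n` on the side `s`. -/
inductive Key : β → α ⊕ β → ℝ → Prop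
  | tree_right (v : α) (hv : v ∈ D.tree.verts) (hr : v ≠ D.tree.root) :
      Key (D.tree.edge v) (.inl v) 1
  | tree_left (v : α) (hv : v ∈ D.tree.verts) (hr : v ≠ D.tree.root) :
      Key (τ (D.tree.edge v)) (.inl v) (-1)
  | crossing (e : β) (he : G.IsCrossing σ τ e) : Key e (.inr e) 1
  | loop_right (e : β) (he : e ∈ D.half) : Key e (.inr e) 1
  | loop_left (e : β) (he : e ∈ D.half) : Key (τ e) (.inr e) (-1)

variable {D}

theorem half_edge_mem {e : β} (he : e ∈ D.half) : e ∈ E(G) := by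
  obtain ⟨x, -, hl⟩ := D.half_link e he
  exact hl.edge_mem

theorem tree_edge_mem {v : α} (hv : v ∈ D.tree.verts) (hr : v ≠ D.tree.root) :
    D.tree.edge v ∈ E(G) :=
  (D.tree.isLink v hv hr).edge_mem

/-- The edges of the tree join different orbits. -/
theorem tree_edge_ends {v : α} (hv : v ∈ D.tree.verts) (hr : v ≠ D.tree.root) {x y : α}
    (hl : G.IsLink (D.tree.edge v) x y) : x ≠ y ∧ σ x ≠ y := by
  have hl' := D.tree.isLink v hv hr
  have hp := D.tree.parent_mem v hv hr
  have hne : D.tree.parent v ≠ v := fun h ↦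
    absurd (D.tree.rank_lt v hv hr) (by rw [h]; exact lt_irrefl _)
  rcases hl.eq_and_eq_or_eq_and_eq hl' with ⟨rfl, rfl⟩ | ⟨rfl, rfl⟩
  · exact ⟨hne.symm, fun h ↦ hne (D.tree.eq_of_mem hv hp (Or.inr h.symm))⟩
  · exact ⟨hne, fun h ↦ hne (D.tree.eq_of_mem hp hv (Or.inr h.symm)).symm⟩

theorem tree_edge_mirror_ends {v : α} (hv : v ∈ D.tree.verts) (hr : v ≠ D.tree.root) {x y : α}
    (hl : G.IsLink (τ (D.tree.edge v)) x y) : x ≠ y ∧ σ x ≠ y := by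
  have hl' := D.mixing.isLink _ _ _ hl
  rw [D.mixing.edge_invol _ (tree_edge_mem hv hr)] at hl'
  obtain ⟨h1, h2⟩ := tree_edge_ends hv hr hl'
  exact ⟨fun h ↦ h1 (by rw [h]), fun h ↦ h2 (by rw [h])⟩

theorem tree_edge_not_crossing {v : α} (hv : v ∈ D.tree.verts) (hr : v ≠ D.tree.root) :
    ¬ G.IsCrossing σ τ (D.tree.edge v) :=
  fun h ↦ (tree_edge_ends hv hr (D.tree.isLink v hv hr)).2
    (h.map_eq D.mixing (D.tree.isLink v hv hr))

theorem tree_edge_injOn {v w : α} (hv : v ∈ D.tree.verts) (hr : v ≠ D.tree.root)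
    (hw : w ∈ D.tree.verts) (hr' : w ≠ D.tree.root) (h : D.tree.edge v = D.tree.edge w) :
    v = w := by
  have hl := D.tree.isLink v hv hr
  have h1 := D.tree.rank_lt v hv hr
  have h2 := D.tree.rank_lt w hw hr'
  rw [h] at hl
  rcases hl.eq_and_eq_or_eq_and_eq (D.tree.isLink w hw hr') with ⟨h, -⟩ | ⟨h, h'⟩
  · exact h
  · rw [h'] at h1
    rw [← h] at h2
    omega

theorem tree_edge_ne_mirror {v w : α} (hv : v ∈ D.tree.verts) (hr : v ≠ D.tree.root)
    (hw : w ∈ D.tree.verts) (hr' : w ≠ D.tree.root) : D.tree.edge v ≠ τ (D.tree.edge w) := by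
  intro h
  have hl := D.tree.isLink v hv hr
  have hp := D.tree.parent_mem v hv hr
  have hp' := D.tree.parent_mem w hw hr'
  have h1 := D.tree.rank_lt v hv hr
  have h2 := D.tree.rank_lt w hw hr'
  rw [h] at hl
  rcases hl.eq_and_eq_or_eq_and_eq (D.mixing.isLink _ _ _ (D.tree.isLink w hw hr')) with
    ⟨h3, -⟩ | ⟨h3, h4⟩
  · obtain rfl := D.tree.eq_of_mem hw hv (Or.inr h3)
    exact (tree_edge_ends hv hr (D.tree.isLink v hv hr)).2
      (D.mixing.mixing _ _ _ (D.tree.isLink v hv hr) h.symm)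
  · have h5 := D.tree.eq_of_mem hp' hv (Or.inr h3)
    have h6 := D.tree.eq_of_mem hw hp (Or.inr h4)
    rw [h6] at h1
    rw [← h5] at h2
    omega

theorem Key.edge_mem {e : β} {n : α ⊕ β} {s : ℝ} (h : D.Key e n s) : e ∈ E(G) := by
  cases h with
  | tree_right v hv hr => exact tree_edge_mem hv hr
  | tree_left v hv hr => exact D.mixing.edge_mem (tree_edge_mem hv hr)
  | crossing e he => exact he.edge_mem
  | loop_right e he => exact half_edge_mem he
  | loop_left e he => exact D.mixing.edge_mem (half_edge_mem he)

theorem Key.node_mem {e : β} {n : α ⊕ β} {s : ℝ} (h : D.Key e n s) : n ∈ D.diagram.nodes := by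
  cases h with
  | tree_right v hv hr => exact (D.inl_mem v).2 hv
  | tree_left v hv hr => exact (D.inl_mem v).2 hv
  | crossing e he => exact (D.inr_mem e).2 he.edge_mem
  | loop_right e he => exact (D.inr_mem e).2 (half_edge_mem he)
  | loop_left e he => exact (D.inr_mem e).2 (half_edge_mem he)

theorem Key.ne_root {e : β} {n : α ⊕ β} {s : ℝ} (h : D.Key e n s) : n ≠ D.diagram.root := by
  rw [D.root_eq]
  cases h <;> simp_all

theorem Key.sign {e : β} {n : α ⊕ β} {s : ℝ} (h : D.Key e n s) : s = 1 ∨ s = -1 := by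
  cases h <;> simp

theorem Key.isCrossing_iff {e : β} {n : α ⊕ β} {s : ℝ} (h : D.Key e n s) :
    G.IsCrossing σ τ e ↔ n.isRight ∧ n ∈ D.diagram.axis := by
  cases h with
  | tree_right v hv hr => simpa using tree_edge_not_crossing hv hr
  | tree_left v hv hr =>
    simpa [IsCrossing.map_iff D.mixing (tree_edge_mem hv hr)] using tree_edge_not_crossing hv hr
  | crossing e he => simp [D.inr_mem_axis e he.edge_mem]
  | loop_right e he => simp [D.inr_mem_axis e (half_edge_mem he)]
  | loop_left e he =>
    simp [D.inr_mem_axis e (half_edge_mem he), IsCrossing.map_iff D.mixing (half_edge_mem he)]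

variable (D) in
theorem exists_key {e : β} (he : e ∈ E(G)) : ∃ n s, D.Key e n s := by
  obtain ⟨x, y, hl⟩ := exists_isLink_of_mem_edgeSet he
  by_cases hc : G.IsCrossing σ τ e
  · exact ⟨_, _, .crossing e hc⟩
  by_cases hxy : y = x
  · subst hxy
    rcases D.mem_half e y hl hc with h | h
    · exact ⟨_, _, .loop_right e h⟩
    · have hk : D.Key (τ (τ e)) _ _ := .loop_left (τ e) h
      rw [D.mixing.edge_invol e he] at hk
      exact ⟨_, _, hk⟩
  · obtain ⟨v, hv, hr, rfl | rfl⟩ := D.edge_eq e x y hl hxy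
      fun h ↦ hc ⟨x, y, hl, h, Or.inl (Ne.symm hxy)⟩
    · exact ⟨_, _, .tree_right v hv hr⟩
    · exact ⟨_, _, .tree_left v hv hr⟩

theorem map_injOn (hσ : G.IsMixingInvolution σ τ) : InjOn τ E(G) := fun e he f hf h ↦ by
  rw [← hσ.edge_invol e he, h, hσ.edge_invol f hf]

/-- An edge is determined by its curve. -/
theorem Key.edge_eq {e e' : β} {n : α ⊕ β} {s s' : ℝ} (h : D.Key e n s) (h' : D.Key e' n s')
    (hs : s = s' ∨ n.isRight ∧ n ∈ D.diagram.axis) : e = e' := by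
  rw [← h'.isCrossing_iff] at hs
  have hc := h.isCrossing_iff.trans h'.isCrossing_iff.symm
  cases h with
  | tree_right v hv hr =>
    have := tree_edge_not_crossing hv hr
    cases h' with
    | tree_right => rfl
    | tree_left => norm_num [← hc, this] at hs
  | tree_left v hv hr =>
    have := tree_edge_not_crossing hv hr
    rw [← IsCrossing.map_iff D.mixing (tree_edge_mem hv hr)] at this
    cases h' with
    | tree_right => norm_num [← hc, this] at hs
    | tree_left => rfl
  | crossing e he =>
    cases h' with
    | crossing => rfl
    | loop_right => rfl
    | loop_left _ he' => exact absurd he (D.half_not_crossing _ he')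
  | loop_right e he =>
    have := D.half_not_crossing e he
    cases h' with
    | crossing => rfl
    | loop_right => rfl
    | loop_left _ he' => norm_num [← hc, this] at hs
  | loop_left e he =>
    have := D.half_not_crossing e he
    rw [← IsCrossing.map_iff D.mixing (half_edge_mem he)] at this
    cases h' with
    | crossing _ he' => exact absurd he' (D.half_not_crossing _ he)
    | loop_right => norm_num [← hc, this] at hs
    | loop_left => rfl

theorem Key.unique {e e' : β} {n n' : α ⊕ β} {s s' : ℝ} (h : D.Key e n s) (h' : D.Key e' n' s')
    (hee : e = e') : n = n' ∧ s = s' := by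
  cases h with
  | tree_right v hv hr =>
    cases h' with
    | tree_right w hw hr' => exact ⟨by rw [tree_edge_injOn hv hr hw hr' hee], rfl⟩
    | tree_left w hw hr' => exact absurd hee (tree_edge_ne_mirror hv hr hw hr')
    | crossing _ he => exact absurd (hee ▸ he) (tree_edge_not_crossing hv hr)
    | loop_right _ he =>
      obtain ⟨x, -, hl⟩ := D.half_link _ he
      exact absurd rfl (tree_edge_ends hv hr (hee ▸ hl)).1
    | loop_left _ he =>
      obtain ⟨x, -, hl⟩ := D.half_link _ he
      exact absurd rfl (tree_edge_ends hv hr (hee ▸ D.mixing.isLink _ _ _ hl)).1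
  | tree_left v hv hr =>
    cases h' with
    | tree_right w hw hr' => exact absurd hee.symm (tree_edge_ne_mirror hw hr' hv hr)
    | tree_left w hw hr' =>
      have := map_injOn D.mixing (tree_edge_mem hv hr) (tree_edge_mem hw hr') hee
      exact ⟨by rw [tree_edge_injOn hv hr hw hr' this], rfl⟩
    | crossing _ he =>
      exact absurd ((IsCrossing.map_iff D.mixing (tree_edge_mem hv hr)).1 (hee ▸ he))
        (tree_edge_not_crossing hv hr)
    | loop_right _ he =>
      obtain ⟨x, -, hl⟩ := D.half_link _ he
      exact absurd rfl (tree_edge_mirror_ends hv hr (hee ▸ hl)).1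
    | loop_left _ he =>
      obtain ⟨x, -, hl⟩ := D.half_link _ he
      exact absurd rfl (tree_edge_mirror_ends hv hr (hee ▸ D.mixing.isLink _ _ _ hl)).1
  | crossing e he =>
    cases h' with
    | tree_right w hw hr' => exact absurd (hee ▸ he) (tree_edge_not_crossing hw hr')
    | tree_left w hw hr' =>
      exact absurd ((IsCrossing.map_iff D.mixing (tree_edge_mem hw hr')).1 (hee ▸ he))
        (tree_edge_not_crossing hw hr')
    | crossing _ he' => exact ⟨by rw [hee], rfl⟩
    | loop_right _ he' => exact ⟨by rw [hee], rfl⟩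
    | loop_left _ he' =>
      exact absurd ((IsCrossing.map_iff D.mixing (half_edge_mem he')).1 (hee ▸ he))
        (D.half_not_crossing _ he')
  | loop_right e he =>
    obtain ⟨x, -, hl⟩ := D.half_link _ he
    cases h' with
    | tree_right w hw hr' => exact absurd rfl (tree_edge_ends hw hr' (hee ▸ hl)).1
    | tree_left w hw hr' => exact absurd rfl (tree_edge_mirror_ends hw hr' (hee ▸ hl)).1
    | crossing _ he' => exact ⟨by rw [hee], rfl⟩
    | loop_right _ he' => exact ⟨by rw [hee], rfl⟩
    | loop_left _ he' => exact absurd (hee ▸ he) (D.half_mirror _ he')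
  | loop_left e he =>
    obtain ⟨x, -, hl⟩ := D.half_link _ he
    have hl := D.mixing.isLink _ _ _ hl
    cases h' with
    | tree_right w hw hr' => exact absurd rfl (tree_edge_ends hw hr' (hee ▸ hl)).1
    | tree_left w hw hr' => exact absurd rfl (tree_edge_mirror_ends hw hr' (hee ▸ hl)).1
    | crossing _ he' =>
      exact absurd ((IsCrossing.map_iff D.mixing (half_edge_mem he)).1 (hee ▸ he'))
        (D.half_not_crossing _ he)
    | loop_right _ he' => exact absurd (hee ▸ he') (D.half_mirror _ he)
    | loop_left _ he' =>
      exact ⟨by rw [map_injOn D.mixing (half_edge_mem he) (half_edge_mem he') hee], rfl⟩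

theorem Key.mirror {e : β} {n : α ⊕ β} {s : ℝ} (h : D.Key e n s) (hc : ¬ G.IsCrossing σ τ e) :
    D.Key (τ e) n (-s) := by
  cases h with
  | tree_right v hv hr => exact .tree_left v hv hr
  | tree_left v hv hr =>
    rw [D.mixing.edge_invol _ (tree_edge_mem hv hr), neg_neg]
    exact .tree_right v hv hr
  | crossing e he => exact absurd he hc
  | loop_right e he => exact .loop_left e he
  | loop_left e he =>
    rw [D.mixing.edge_invol _ (half_edge_mem he), neg_neg]
    exact .loop_right e he

/-! The points of the vertices. -/

variable (D) in
open Classical in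
/-- The point of a vertex. -/
noncomputable def pt (v : α) : ℝ × ℝ :=
  if v ∈ D.tree.verts then D.diagram.point v 1 else D.diagram.point (σ v) (-1)

theorem point_eq_of_fixed {v : α} (hv : v ∈ D.tree.verts) (h : σ v = v) (s s' : ℝ) :
    D.diagram.point v s = D.diagram.point v s' := by
  have := (D.diagram.width_height_eq_zero_iff ((D.inl_mem v).2 hv)).2 ((D.inl_mem_axis v hv).2 h)
  simp [ArcDiagram.point, this]

theorem pt_of_mem {v : α} (hv : v ∈ D.tree.verts) : D.pt v = D.diagram.point v 1 := if_pos hv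

theorem pt_map {v : α} (hv : v ∈ D.tree.verts) : D.pt (σ v) = D.diagram.point v (-1) := by
  by_cases h : σ v ∈ D.tree.verts
  · have hfix := D.tree.fixed v hv h
    rw [hfix, pt_of_mem hv]
    exact point_eq_of_fixed hv hfix _ _
  · rw [pt, if_neg h, D.mixing.vertex_invol v (D.tree.subset v hv)]

variable (D) in
theorem exists_pt_eq {v : α} (hv : v ∈ V(G)) : ∃ w ∈ D.tree.verts,
    (v = w ∧ D.pt v = D.diagram.point w 1) ∨ (v = σ w ∧ D.pt v = D.diagram.point w (-1)) := by
  rcases D.spanning v hv with h | h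
  · exact ⟨v, h, Or.inl ⟨rfl, pt_of_mem h⟩⟩
  · have h' := D.mixing.vertex_invol v hv
    refine ⟨σ v, h, Or.inr ⟨h'.symm, ?_⟩⟩
    rw [← pt_map h, h']

theorem pt_map_eq_reflect {v : α} (hv : v ∈ V(G)) :
    D.pt (σ v) = PlaneEmbedding.reflect (D.pt v) := by
  obtain ⟨w, hw, ⟨rfl, h⟩ | ⟨rfl, h⟩⟩ := D.exists_pt_eq hv
  · rw [h, pt_map hw, ArcDiagram.reflect_point]
  · rw [h, D.mixing.vertex_invol w (D.tree.subset w hw), pt_of_mem hw, ArcDiagram.reflect_point,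
      neg_neg]

theorem height_inl_injOn {v w : α} (hv : v ∈ D.tree.verts) (hw : w ∈ D.tree.verts)
    (h : (D.diagram.height (.inl v) : ℝ) = D.diagram.height (.inl w)) : v = w :=
  Sum.inl_injective
    (D.diagram.height_injOn ((D.inl_mem v).2 hv) ((D.inl_mem w).2 hw) (by exact_mod_cast h))

theorem width_pos {v : α} (hv : v ∈ D.tree.verts) (h : σ v ≠ v) :
    0 < D.diagram.width (D.diagram.height (.inl v)) :=
  D.diagram.width_height_pos ((D.inl_mem v).2 hv) (by rwa [D.inl_mem_axis v hv])

variable (D) in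
theorem pt_injOn : InjOn D.pt V(G) := by
  intro v hv v' hv' h
  obtain ⟨w, hw, h1⟩ := D.exists_pt_eq hv
  obtain ⟨w', hw', h1'⟩ := D.exists_pt_eq hv'
  have hww : w = w' := by
    refine height_inl_injOn hw hw' ?_
    rcases h1 with ⟨-, h1⟩ | ⟨-, h1⟩ <;> rcases h1' with ⟨-, h1'⟩ | ⟨-, h1'⟩ <;>
      exact (Prod.mk.inj (h1.symm.trans (h.trans h1'))).2
  subst hww
  by_cases hfix : σ w = w
  · rw [hfix] at h1 h1'
    rcases h1 with ⟨rfl, -⟩ | ⟨rfl, -⟩ <;> rcases h1' with ⟨rfl, -⟩ | ⟨rfl, -⟩ <;> rfl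
  · have hpos := width_pos hw hfix
    rcases h1 with ⟨rfl, h1⟩ | ⟨rfl, h1⟩ <;> rcases h1' with ⟨rfl, h1'⟩ | ⟨rfl, h1'⟩
    · rfl
    · have := (Prod.mk.inj (h1.symm.trans (h.trans h1'))).1
      linarith
    · have := (Prod.mk.inj (h1.symm.trans (h.trans h1'))).1
      linarith
    · rfl

theorem width_lt_abs_of_key {e : β} {n : α ⊕ β} {s : ℝ} (h : D.Key e n s) {t : ℝ}
    (ht : t ∈ Ioo (0 : ℝ) 1) {v : α} (hv : v ∈ D.tree.verts)
    (hh : (D.diagram.draw n s t).2 = D.diagram.height (.inl v)) :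
    D.diagram.width (D.diagram.height (.inl v)) < |(D.diagram.draw n s t).1| :=
  ArcDiagram.width_lt_abs_of_draw h.node_mem h.ne_root h.sign ht ((D.inl_mem v).2 hv) hh

theorem Key.draw_ne_pt {e : β} {n : α ⊕ β} {s : ℝ} (h : D.Key e n s) {t : ℝ}
    (ht : t ∈ Ioo (0 : ℝ) 1) {v : α} (hv : v ∈ V(G)) : D.diagram.draw n s t ≠ D.pt v := by
  intro heq
  obtain ⟨w, hw, h1⟩ := D.exists_pt_eq hv
  have h2 : ∃ r : ℝ, (r = 1 ∨ r = -1) ∧ D.diagram.draw n s t = D.diagram.point w r := by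
    rcases h1 with ⟨-, h1⟩ | ⟨-, h1⟩
    · exact ⟨1, Or.inl rfl, heq.trans h1⟩
    · exact ⟨-1, Or.inr rfl, heq.trans h1⟩
  obtain ⟨r, hr, h2⟩ := h2
  have h3 := width_lt_abs_of_key h ht hw (by rw [h2]; rfl)
  rw [h2] at h3
  exact h3.ne (ArcDiagram.abs_sign_mul hr (D.diagram.width_nonneg _)).symm

theorem Key.draw_ends {e : β} {n : α ⊕ β} {s : ℝ} (h : D.Key e n s) :
    ∃ x y, G.IsLink e x y ∧ D.diagram.draw n s 0 = D.pt x ∧ D.diagram.draw n s 1 = D.pt y := by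
  have hloop : ∀ e ∈ D.half, G.IsLink e (D.foot e) (D.foot e) := by
    intro e he
    obtain ⟨z, hz, hl⟩ := D.half_link e he
    obtain ⟨x, y, hl', hf⟩ := D.foot_eq e hl.edge_mem
    obtain rfl : x = z := by rcases hl'.left_eq_or_eq hl with h | h <;> exact h
    rwa [D.tree.eq_of_mem hz (D.foot_mem e hl.edge_mem) hf]
  have haxis : ∀ e ∈ D.half, .inr e ∉ D.diagram.axis := by
    intro e he
    rw [D.inr_mem_axis e (half_edge_mem he)]
    exact D.half_not_crossing e he
  cases h with
  | tree_right v hv hr =>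
    refine ⟨_, _, (D.tree.isLink v hv hr).symm, ?_, ?_⟩
    · rw [ArcDiagram.draw_inl_zero (D.parent_inl v), pt_of_mem (D.tree.parent_mem v hv hr)]
    · rw [ArcDiagram.draw_inl_one, pt_of_mem hv]
  | tree_left v hv hr =>
    refine ⟨_, _, D.mixing.isLink _ _ _ (D.tree.isLink v hv hr).symm, ?_, ?_⟩
    · rw [ArcDiagram.draw_inl_zero (D.parent_inl v), pt_map (D.tree.parent_mem v hv hr)]
    · rw [ArcDiagram.draw_inl_one, pt_map hv]
  | crossing e he =>
    have hfm := D.foot_mem e he.edge_mem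
    refine ⟨D.foot e, σ (D.foot e), ?_, ?_, ?_⟩
    · obtain ⟨x, y, hl, hf | hf⟩ := D.foot_eq e he.edge_mem
      · rwa [hf, he.map_eq D.mixing hl]
      · rw [hf, D.mixing.vertex_invol x hl.left_mem, he.map_eq D.mixing hl]
        exact hl.symm
    · rw [ArcDiagram.draw_inr_of_mem _ ((D.inr_mem_axis e he.edge_mem).2 he),
        ArcDiagram.fold_zero (D.parent_inr e), pt_of_mem hfm]
    · rw [ArcDiagram.draw_inr_of_mem _ ((D.inr_mem_axis e he.edge_mem).2 he),
        ArcDiagram.fold_one (D.parent_inr e), pt_map hfm]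
  | loop_right e he =>
    have hfm := D.foot_mem e (half_edge_mem he)
    rw [ArcDiagram.draw_inr_of_notMem _ (haxis e he), ArcDiagram.fold_zero (D.parent_inr e),
      ArcDiagram.fold_one (D.parent_inr e)]
    exact ⟨_, _, hloop e he, (pt_of_mem hfm).symm, (pt_of_mem hfm).symm⟩
  | loop_left e he =>
    have hfm := D.foot_mem e (half_edge_mem he)
    rw [ArcDiagram.draw_inr_of_notMem _ (haxis e he), ArcDiagram.fold_zero (D.parent_inr e),
      ArcDiagram.fold_one (D.parent_inr e)]
    exact ⟨_, _, D.mixing.isLink _ _ _ (hloop e he), (pt_map hfm).symm, (pt_map hfm).symm⟩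

end MirrorDiagram

end Graph

namespace Graph

variable {α β : Type*} {G : Graph α β} {σ : α → α} {τ : β → β}

namespace PlaneEmbedding

/-- Two vertices which lie in the closure of a connected subset of the complement of the image lie
on a common face. -/
theorem onCommonFace_of_isPreconnected (ρ : G.PlaneEmbedding) {v w : α} (hv : v ∈ V(G))
    (hw : w ∈ V(G)) {C : Set (ℝ × ℝ)} (hC : IsPreconnected C) (hsub : C ⊆ ρ.imageᶜ)
    (hvC : ρ.pt v ∈ closure C) (hwC : ρ.pt w ∈ closure C) : ρ.OnCommonFace v w := by
  obtain ⟨p, hp⟩ : C.Nonempty := closure_nonempty_iff.1 ⟨_, hvC⟩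
  have hCF : C ⊆ connectedComponentIn ρ.imageᶜ p := hC.subset_connectedComponentIn hp hsub
  have hfr : ∀ u ∈ V(G), ρ.pt u ∈ closure C →
      ρ.pt u ∈ frontier (connectedComponentIn ρ.imageᶜ p) := by
    refine fun u hu huC ↦ ⟨closure_mono hCF huC, fun hint ↦ ?_⟩
    exact connectedComponentIn_subset _ _ (interior_subset hint)
      (Or.inl (mem_image_of_mem _ hu))
  exact ⟨_, ⟨p, hsub hp, rfl⟩, hfr v hv hvC, hfr w hw hwC⟩

theorem reflect_reflect (p : ℝ × ℝ) : reflect (reflect p) = p := by simp [reflect]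

end PlaneEmbedding

namespace MirrorDiagram

variable (D : G.MirrorDiagram σ τ)

/-- The plane embedding that draws each edge as the curve of its key. -/
noncomputable def embedding (node : β → α ⊕ β) (side : β → ℝ)
    (hkey : ∀ e ∈ E(G), D.Key e (node e) (side e)) : G.PlaneEmbedding where
  pt := D.pt
  arc e := D.diagram.draw (node e) (side e)
  pt_injOn := D.pt_injOn
  arc_continuousOn e he := (ArcDiagram.continuous_draw (hkey e he).node_mem _).continuousOn
  arc_ends e he := (hkey e he).draw_ends
  arc_injOn e he :=
    ArcDiagram.draw_injOn (hkey e he).node_mem (hkey e he).ne_root (hkey e he).sign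
  arc_ne_pt e he _ ht _ hv := (hkey e he).draw_ne_pt ht hv
  arc_ne_arc e he e' he' hne s hs t ht h := by
    have hk := hkey e he
    have hk' := hkey e' he'
    obtain ⟨h1, h2⟩ := ArcDiagram.draw_eq_draw hk.node_mem hk'.node_mem hk.ne_root hk'.ne_root
      hk.sign hk'.sign hs ht h
    rw [← h1] at hk'
    exact hne (hk.edge_eq hk' h2)

theorem embedding_isSymmetric (node : β → α ⊕ β) (side : β → ℝ)
    (hkey : ∀ e ∈ E(G), D.Key e (node e) (side e)) :
    (D.embedding node side hkey).IsSymmetric σ τ := by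
  have hcross : ∀ e, G.IsCrossing σ τ e →
      (D.embedding node side hkey).curve e =
        PlaneEmbedding.reflect '' (D.embedding node side hkey).curve e := by
    intro e hc
    obtain ⟨hn, -⟩ := (hkey e hc.edge_mem).unique (.crossing e hc) rfl
    have hax := (D.inr_mem_axis e hc.edge_mem).2 hc
    have hsub : PlaneEmbedding.reflect '' (D.embedding node side hkey).curve e ⊆
        (D.embedding node side hkey).curve e := by
      rintro _ ⟨_, ⟨t, ht, rfl⟩, rfl⟩
      refine ⟨1 - t, ⟨by linarith [ht.2], by linarith [ht.1]⟩, ?_⟩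
      change D.diagram.draw (node e) (side e) _ =
        PlaneEmbedding.reflect (D.diagram.draw (node e) (side e) t)
      rw [hn, ArcDiagram.draw_one_sub hax]
    refine Subset.antisymm (fun p hp ↦ ?_) hsub
    exact ⟨_, hsub (mem_image_of_mem _ hp), PlaneEmbedding.reflect_reflect p⟩
  refine ⟨fun v hv ↦ pt_map_eq_reflect hv, ?_, ?_⟩
  · intro e x y hl hxy
    by_cases hc : G.IsCrossing σ τ e
    · have hfix : τ e = e := by
        obtain ⟨a, b, hl', h1, h2 | h2⟩ := hc
        · rcases hl.eq_and_eq_or_eq_and_eq hl' with ⟨rfl, rfl⟩ | ⟨rfl, rfl⟩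
          · exact absurd ⟨h2, h1⟩ hxy
          · exact absurd ⟨h2.symm, IsCrossing.map_eq D.mixing ⟨_, _, hl', h1, Or.inl h2⟩ hl⟩ hxy
        · exact h2
      rw [hfix]
      exact hcross e hc
    · have hk := hkey e hl.edge_mem
      obtain ⟨h1, h2⟩ := (hkey (τ e) (D.mixing.edge_mem hl.edge_mem)).unique (hk.mirror hc) rfl
      rw [PlaneEmbedding.curve, PlaneEmbedding.curve, image_image]
      refine image_congr fun t _ ↦ ?_
      change D.diagram.draw (node (τ e)) (side (τ e)) t =
        PlaneEmbedding.reflect (D.diagram.draw (node e) (side e) t)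
      rw [h1, h2, ArcDiagram.reflect_draw _ _ _ (fun h ↦ hc (hk.isCrossing_iff.2 h))]
  · exact fun e x y hl hne hxy ↦ hcross e ⟨x, y, hl, hxy, Or.inl hne⟩

theorem embedding_onCommonFace (node : β → α ⊕ β) (side : β → ℝ)
    (hkey : ∀ e ∈ E(G), D.Key e (node e) (side e)) {v : α} (hv : v ∈ D.tree.verts)
    (hne : σ v ≠ v) : (D.embedding node side hkey).OnCommonFace v (σ v) := by
  have hvV := D.tree.subset v hv
  have hpos := width_pos hv hne
  set w := D.diagram.width (D.diagram.height (.inl v))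
  set y : ℝ := ((D.diagram.height (.inl v) : ℤ) : ℝ)
  have hpt : ∀ u ∈ V(G), (D.pt u).2 = y → |(D.pt u).1| = w := by
    intro u hu h
    obtain ⟨z, hz, ⟨-, h1⟩ | ⟨-, h1⟩⟩ := D.exists_pt_eq hu <;>
    · rw [h1] at h ⊢
      obtain rfl := height_inl_injOn hz hv h
      exact ArcDiagram.abs_sign_mul (by norm_num) hpos.le
  have hcont : Continuous fun x : ℝ ↦ (x, y) := by fun_prop
  have hcl : ∀ x ∈ Icc (-w) w, (x, y) ∈ closure ((fun x : ℝ ↦ (x, y)) '' Ioo (-w) w) := by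
    intro x hx
    rw [← closure_Ioo (by linarith)] at hx
    exact image_closure_subset_closure_image hcont (mem_image_of_mem _ hx)
  refine PlaneEmbedding.onCommonFace_of_isPreconnected _ hvV (D.mixing.vertex_mem v hvV)
    ((isPreconnected_Ioo (a := -w) (b := w)).image _ hcont.continuousOn) ?_ ?_ ?_
  · rintro _ ⟨x, hx, rfl⟩ him
    have hx' : |x| < w := abs_lt.2 hx
    have hnpt : ∀ u ∈ V(G), D.pt u ≠ (x, y) := by
      intro u hu h
      have := hpt u hu (by rw [h])
      rw [h] at this
      exact hx'.ne this
    rcases him with ⟨u, hu, h⟩ | him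
    · exact hnpt u hu h
    · obtain ⟨e, he, t, ht, h⟩ : ∃ e ∈ E(G), ∃ t ∈ Icc (0 : ℝ) 1,
          D.diagram.draw (node e) (side e) t = (x, y) := by
        simpa [PlaneEmbedding.curve, embedding] using him
      obtain ⟨a, b, hl, ha, hb⟩ := (hkey e he).draw_ends
      rcases eq_or_lt_of_le ht.1 with rfl | h0
      · exact hnpt a hl.left_mem (ha.symm.trans h)
      · rcases eq_or_lt_of_le ht.2 with rfl | h1
        · exact hnpt b hl.right_mem (hb.symm.trans h)
        · have := width_lt_abs_of_key (hkey e he) ⟨h0, h1⟩ hv (by rw [h])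
          rw [h] at this
          exact lt_asymm this hx'
  · change D.pt v ∈ _
    rw [pt_of_mem hv, ArcDiagram.point, one_mul]
    exact hcl w ⟨by linarith, le_rfl⟩
  · change D.pt (σ v) ∈ _
    rw [pt_map hv, ArcDiagram.point, neg_one_mul]
    exact hcl (-w) ⟨le_rfl, by linarith⟩

end MirrorDiagram

theorem PlaneEmbedding.OnCommonFace.symm {ρ : G.PlaneEmbedding} {v w : α}
    (h : ρ.OnCommonFace v w) : ρ.OnCommonFace w v := by
  obtain ⟨F, hF, hv, hw⟩ := h
  exact ⟨F, hF, hw, hv⟩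

theorem IsHyperellipticInvolution.exists_embedding (hV : V(G).Finite) (hE : E(G).Finite)
    (h : G.IsHyperellipticInvolution σ τ) :
    ∃ ρ : G.PlaneEmbedding, ρ.IsSymmetric σ τ ∧
      ∀ v ∈ V(G), σ v ≠ v → ρ.OnCommonFace v (σ v) := by
  obtain ⟨D⟩ := exists_mirrorDiagram hV hE h
  have hkey : ∀ e, ∃ n s, e ∈ E(G) → D.Key e n s := by
    intro e
    by_cases he : e ∈ E(G)
    · obtain ⟨n, s, hk⟩ := D.exists_key he
      exact ⟨n, s, fun _ ↦ hk⟩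
    · exact ⟨.inr e, 1, fun h ↦ absurd h he⟩
  choose node side hkey using hkey
  refine ⟨D.embedding node side hkey, D.embedding_isSymmetric node side hkey, fun v hv hne ↦ ?_⟩
  rcases D.spanning v hv with h | h
  · exact D.embedding_onCommonFace node side hkey h hne
  · have hvv := D.mixing.vertex_invol v hv
    have := D.embedding_onCommonFace node side hkey h (by rw [hvv]; exact hne.symm)
    rw [hvv] at this
    exact this.symm

end Graph

theorem mainTheorem1 {α β : Type*} (G : Graph α β) (hV : V(G).Finite) (hE : E(G).Finite) :
    (G.IsHyperelliptic → G.IsPlanar) ∧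
    ∀ (σ : α → α) (τ : β → β), G.IsHyperellipticInvolution σ τ →
      ∃ ρ : G.PlaneEmbedding, ρ.IsSymmetric σ τ ∧
        ∀ v ∈ V(G), σ v ≠ v → ρ.OnCommonFace v (σ v) := by
  refine ⟨?_, fun σ τ h ↦ h.exists_embedding hV hE⟩
  rintro ⟨σ, τ, h⟩
  obtain ⟨ρ, -⟩ := h.exists_embedding hV hE
  exact ⟨ρ⟩
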